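/- **Corollary (characterization of singletons, $\mathrm{MBanAlg}$).** *Conventions.* Vector spaces are complex, $\mathbb{N}=\{1,2,3,\dots\}$, and $M_{m,n}(S)$ is the set of $m\times n$ arrays with entries in a set $S$. A function $f:S\to T$ acts entrywise by $M_{m,n}(f):M_{m,n}(S)\to M_{m,n}(T)$. The space $\mathbb{M}_{m,n}=M_{m,n}(\mathbb{C})$ has the operator norm between Euclidean spaces, and $\mathbb{M}_{n,m}^*$ is $\mathbb{M}_{m,n}$ with the trace norm. *Matricial Banach spaces and algebras.* A matrix-norm on a vector space $V$ is a family of norms $\|\cdot\|_{V,m,n}$ on $M_{m,n}(V)$ $(m,n\in\mathbb{N})$ such that $\|ABC\|\le\|A\|\,\|B\|\,\|C\|$ for scalar matrices $A,C$ and arrays $B$ over $V$ of matching sizes. A matricial Banach space is a vector space with a matrix-norm that is complete for $\|\cdot\|_{V,1,1}$. A matricial Banach algebra is a matricial Banach space with an associative bilinear product (not necessarily unital) such that $\|AB\|_{m,n}\le\|A\|_{m,p}\|B\|_{p,n}$ for all arrays $A$, $B$ of sizes $m\times p$, $p\times n$. A completely isometric isomorphism of matricial Banach algebras is a bijective algebra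 homomorphism $\varphi$ such that $\|M_{m,n}(\varphi)(A)\|=\|A\|$ for all $m,n$ and all $A$. For a Banach space $V$, $\mathrm{MIN}(V)$ and $\mathrm{AMAX}(V)$ denote $V$ with $$\|A\|_{\mathrm{MIN}(V),m,n}=\sup\{\|M_{m,n}(\phi)(A)\|_{\mathbb{M}_{m,n}}:\phi\in V^*,\ \|\phi\|\le1\},$$ $$\|A\|_{\mathrm{AMAX}(V),m,n}=\inf\Big\{\sum_{l=1}^p\|v_l\|\,\|C_l\|_{\mathbb{M}_{n,m}^*}:A=\sum_{l=1}^pv_l\otimes C_l\Big\}.$$ *Array-weighted sets.* An array-weight on a set $X$ is a family of functions $w_{X,m,n}:M_{m,n}(X)\to[0,\infty)$ $(m,n\in\mathbb{N})$ such that the weight of a subarray, obtained by choosing distinct rows and distinct columns in any order, is at most the weight of the array, and such that the weight of an array is at most the sum of the weights of the two subarrays obtained by distributing its rows, or its columns, into two non-empty parts. Put $$\mathrm{brn}(X)=\inf\Big\{\frac{w_{X,m,n}(A)}{\sqrt{mn}}:m,n\in\mathbb{N},\ A\in M_{m,n}(X)\Big\}.$$ A function $f$ from $X$ to a matricial Banach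 space $W$ is completely contractive if $\|M_{m,n}(f)(A)\|_{W,m,n}\le w_{X,m,n}(A)$ for all $m,n$ and $A$. *The free constructions.* Let $V_X$ be the free vector space on $X$, let $N_X\subseteq V_X$ be the common kernel of all linear $\phi:V_X\to\mathrm{MIN}(\mathbb{C})$ that are completely contractive on $X$, and let $Q_X=V_X/N_X$ with $$\|A\|_{Q_X,m,n}=\sup\|M_{m,n}(\phi)(A)\|_{W,m,n},$$ the supremum over all matricial Banach spaces $W$ and all linear $\phi:Q_X\to W$ that are completely contractive on the generators from $X$. The space $\mathrm{MBanSp}(X)$ is the completion of $Q_X$, with the matrix-norm extended by continuity. For matricial Banach spaces $V,W$, the Haagerup tensor product $V\otimes_hW$ is the completion of $V\otimes W$ in the matrix-norm $$\|C\|_{m,n}=\inf\Big\{\sum_{l}\|A_l\|_{V,m,q_l}\|B_l\|_{W,q_l,n}:C=\sum_lA_l\odot B_l\Big\},\qquad(A\odot B)(i,k)=\sum_jA(i,j)\otimes B(j,k).$$ Let $V^{\otimes_h1}=V$ and $V^{\otimes_h(n+1)}=V^{\otimes_hn}\otimes_hV$. The Haagerup tensor algebra $\mathcal{T}_h(V)$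 is the $\ell^1$-direct sum of the $V^{\otimes_hn}$, $n\ge1$, with $\|A\|_{m,n}=\sum_{k\ge1}\|M_{m,n}(\pi_k)(A)\|_{V^{\otimes_hk},m,n}$, where $\pi_k$ is the $k$-th coordinate projection, and with the tensor multiplication given by the canonical maps $V^{\otimes_hj}\otimes_h V^{\otimes_hk}\to V^{\otimes_h(j+k)}$. Put $\mathrm{MBanAlg}(X)=\mathcal{T}_h(\mathrm{MBanSp}(X))$. *Statement.* Let $X=\{x\}$ be a singleton array-weighted set. * If $\mathrm{brn}(X)>0$, then $\mathrm{MBanAlg}(X)$ and $\mathrm{AMAX}(\ell^1)$ are matricial Banach algebras and there is a completely isometric isomorphism of matricial Banach algebras between them. Here $\ell^1=\ell^1(\mathbb{N})$ is the Banach space of absolutely summable sequences $(x_n)_{n\ge1}$ with the convolution product $(x*y)_n=\sum_{k=1}^{n-1}x_ky_{n-k}$, so that $\delta_j*\delta_k=\delta_{j+k}$. * If $\mathrm{brn}(X)=0$, then $\mathrm{MBanAlg}(X)$ is a matricial Banach algebra, completely isometrically isomorphic to the zero algebra $\{0\}$. -/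

import Mathlib

open scoped TensorProduct Topology
open UniformSpace (Completion)

universe u

noncomputable section

namespace MatBan

/-! ### Arrays, scalar matrices, matrix-norms -/

/-- `m × n` arrays with entries from `S`. -/
abbrev Mat (m n : ℕ) (S : Type*) : Type _ := Fin m → Fin n → S

/-- The entrywise action of a function on arrays (the ampliation of `f`). -/
def ampl {S T : Type*} (f : S → T) {m n : ℕ} (A : Mat m n S) : Mat m n T :=
  fun i j => f (A i j)

open scoped Matrix.Norms.L2Operator in
/-- The operator norm of a complex matrix between Euclidean spaces. -/
def opNorm {m n : ℕ} (A : Matrix (Fin m) (Fin n) ℂ) : ℝ := ‖A‖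

/-- The linear functional `B ↦ trace (C B)` on `𝕄_{n,m}` given by `C ∈ 𝕄_{m,n}`. -/
def traceFunctional {m n : ℕ} (C : Matrix (Fin m) (Fin n) ℂ) :
    Matrix (Fin n) (Fin m) ℂ →ₗ[ℂ] ℂ where
  toFun B := (C * B).trace
  map_add' B D := by rw [Matrix.mul_add, Matrix.trace_add]
  map_smul' c B := by rw [Matrix.mul_smul, Matrix.trace_smul]; rfl

open scoped Matrix.Norms.L2Operator in
/-- The trace norm of `C ∈ 𝕄_{m,n}`: the norm of the functional `B ↦ trace (C B)` in the dual
space of `𝕄_{n,m}`, the latter with its operator norm. -/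
def traceNorm {m n : ℕ} (C : Matrix (Fin m) (Fin n) ℂ) : ℝ :=
  ‖LinearMap.toContinuousLinearMap (traceFunctional C)‖

/-- The product `A B C` of an array `B` of vectors with scalar matrices `A` and `C`. -/
def act {V : Type*} [AddCommGroup V] [Module ℂ V] {k m n l : ℕ}
    (A : Matrix (Fin k) (Fin m) ℂ) (B : Mat m n V) (C : Matrix (Fin n) (Fin l) ℂ) : Mat k l V :=
  fun i j => ∑ a, ∑ b, (A i a * C b j) • B a b

/-- A family of seminorms on all `M_{m,n}(V)`, compatible with the scalar matrices.  A matrix-norm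
is such a family for which each member is a norm; see `MBan.mat_eq_zero`.  (The levels `m = 0` and
`n = 0` are zero spaces and carry no information.) -/
structure MatrixSeminorm (V : Type*) [AddCommGroup V] [Module ℂ V] where
  toFun : ∀ m n : ℕ, Mat m n V → ℝ
  nonneg : ∀ {m n} (A : Mat m n V), 0 ≤ toFun m n A
  add_le : ∀ {m n} (A B : Mat m n V), toFun m n (A + B) ≤ toFun m n A + toFun m n B
  smul : ∀ {m n} (c : ℂ) (A : Mat m n V), toFun m n (c • A) = ‖c‖ * toFun m n A
  act_le : ∀ {k m n l} (A : Matrix (Fin k) (Fin m) ℂ) (B : Mat m n V)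
    (C : Matrix (Fin n) (Fin l) ℂ), toFun k l (act A B C) ≤ opNorm A * toFun m n B * opNorm C

/-- A matricial Banach space: a Banach space with a matrix-norm whose `(1,1)` level is the given
norm. -/
structure MBan where
  carrier : Type u
  [grp : NormedAddCommGroup carrier]
  [mod : NormedSpace ℂ carrier]
  [cpl : CompleteSpace carrier]
  mat : MatrixSeminorm carrier
  mat_one : ∀ v : carrier, mat.toFun 1 1 (fun _ _ => v) = ‖v‖

instance : CoeSort MBan.{u} (Type u) := ⟨MBan.carrier⟩

attribute [instance] MBan.grp MBan.mod MBan.cpl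

/-- `‖A‖_{V,m,n}`. -/
abbrev MBan.norm (V : MBan.{u}) {m n : ℕ} (A : Mat m n V) : ℝ := V.mat.toFun m n A

/-! #### Basic facts -/

section basic

open scoped Matrix.Norms.L2Operator

theorem opNorm_nonneg {m n : ℕ} (A : Matrix (Fin m) (Fin n) ℂ) : 0 ≤ opNorm A := norm_nonneg A

theorem opNorm_mul_le {m n l : ℕ} (A : Matrix (Fin m) (Fin n) ℂ) (B : Matrix (Fin n) (Fin l) ℂ) :
    opNorm (A * B) ≤ opNorm A * opNorm B := Matrix.l2_opNorm_mul A B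

theorem opNorm_one_le (n : ℕ) : opNorm (1 : Matrix (Fin n) (Fin n) ℂ) ≤ 1 := by
  unfold opNorm
  rw [← Matrix.diagonal_one, Matrix.l2_opNorm_diagonal]
  exact (pi_norm_le_iff_of_nonneg zero_le_one).2 (by simp)

theorem opNorm_smul_one_le (c : ℂ) (n : ℕ) :
    opNorm (c • (1 : Matrix (Fin n) (Fin n) ℂ)) ≤ ‖c‖ := by
  unfold opNorm
  rw [norm_smul]
  exact mul_le_of_le_one_right (norm_nonneg c) (opNorm_one_le n)

theorem opNorm_single_le {m n : ℕ} (i : Fin m) (j : Fin n) :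
    opNorm (Matrix.single i j (1 : ℂ)) ≤ 1 := by
  have h := Matrix.l2_opNorm_conjTranspose_mul_self (Matrix.single i j (1 : ℂ))
  have h2 : ‖(Matrix.single i j (1 : ℂ)).conjTranspose * Matrix.single i j (1 : ℂ)‖ ≤ 1 := by
    rw [Matrix.conjTranspose_single, Matrix.single_mul_single_same, star_one, mul_one,
      ← Matrix.diagonal_single, Matrix.l2_opNorm_diagonal]
    refine (pi_norm_le_iff_of_nonneg zero_le_one).2 fun k => ?_
    by_cases hk : k = j
    · subst hk; simp
    · simp [hk]
  unfold opNorm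
  nlinarith [norm_nonneg (Matrix.single i j (1 : ℂ))]

theorem traceNorm_nonneg {m n : ℕ} (C : Matrix (Fin m) (Fin n) ℂ) : 0 ≤ traceNorm C :=
  norm_nonneg (LinearMap.toContinuousLinearMap (traceFunctional C))

theorem norm_trace_le {m n : ℕ} (C : Matrix (Fin m) (Fin n) ℂ) (B : Matrix (Fin n) (Fin m) ℂ) :
    ‖(C * B).trace‖ ≤ traceNorm C * opNorm B :=
  ContinuousLinearMap.le_opNorm (LinearMap.toContinuousLinearMap (traceFunctional C)) B

theorem traceNorm_le {m n : ℕ} (C : Matrix (Fin m) (Fin n) ℂ) {K : ℝ} (hK : 0 ≤ K)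
    (h : ∀ B : Matrix (Fin n) (Fin m) ℂ, ‖(C * B).trace‖ ≤ K * opNorm B) : traceNorm C ≤ K :=
  ContinuousLinearMap.opNorm_le_bound _ hK h

theorem traceNorm_mul_mul_le {k m n l : ℕ} (A : Matrix (Fin k) (Fin m) ℂ)
    (C : Matrix (Fin m) (Fin n) ℂ) (D : Matrix (Fin n) (Fin l) ℂ) :
    traceNorm (A * C * D) ≤ opNorm A * traceNorm C * opNorm D := by
  refine traceNorm_le _ (mul_nonneg (mul_nonneg (opNorm_nonneg _) (traceNorm_nonneg _))
    (opNorm_nonneg _)) fun B => ?_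
  have h : (A * C * D * B).trace = (C * (D * B * A)).trace := by
    rw [Matrix.mul_assoc, Matrix.mul_assoc, Matrix.trace_mul_comm]
    simp only [Matrix.mul_assoc]
  rw [h]
  calc _ ≤ traceNorm C * opNorm (D * B * A) := norm_trace_le _ _
    _ ≤ traceNorm C * (opNorm D * opNorm B * opNorm A) := by
        refine mul_le_mul_of_nonneg_left ?_ (traceNorm_nonneg _)
        exact (opNorm_mul_le _ _).trans
          (mul_le_mul_of_nonneg_right (opNorm_mul_le _ _) (opNorm_nonneg _))
    _ = _ := by ring

end basic

section act

variable {V W : Type*} [AddCommGroup V] [Module ℂ V] [AddCommGroup W] [Module ℂ W]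

theorem act_add {k m n l : ℕ} (A : Matrix (Fin k) (Fin m) ℂ) (B B' : Mat m n V)
    (C : Matrix (Fin n) (Fin l) ℂ) : act A (B + B') C = act A B C + act A B' C := by
  ext i j; simp [act, smul_add, Finset.sum_add_distrib]

theorem act_zero {k m n l : ℕ} (A : Matrix (Fin k) (Fin m) ℂ) (C : Matrix (Fin n) (Fin l) ℂ) :
    act A (0 : Mat m n V) C = 0 := by
  ext i j; simp [act]

theorem act_smul_one {m n : ℕ} (c : ℂ) (B : Mat m n V) :
    act (c • (1 : Matrix (Fin m) (Fin m) ℂ)) B (1 : Matrix (Fin n) (Fin n) ℂ) = c • B := by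
  ext i j
  simp only [act, Matrix.smul_apply, Matrix.one_apply, Pi.smul_apply, smul_eq_mul]
  rw [Finset.sum_eq_single i, Finset.sum_eq_single j]
  · simp
  · intro b _ hb; simp [hb]
  · simp
  · intro a _ ha; simp [Ne.symm ha]
  · simp

theorem ampl_act (f : V →ₗ[ℂ] W) {k m n l : ℕ} (A : Matrix (Fin k) (Fin m) ℂ) (B : Mat m n V)
    (C : Matrix (Fin n) (Fin l) ℂ) : ampl f (act A B C) = act A (ampl f B) C := by
  ext i j; simp [act, ampl, map_sum]

/-- Homogeneity is automatic from compatibility with the scalar matrices. -/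
def MatrixSeminorm.ofAct (N : ∀ m n : ℕ, Mat m n V → ℝ)
    (nonneg : ∀ {m n} (A : Mat m n V), 0 ≤ N m n A)
    (add_le : ∀ {m n} (A B : Mat m n V), N m n (A + B) ≤ N m n A + N m n B)
    (act_le : ∀ {k m n l} (A : Matrix (Fin k) (Fin m) ℂ) (B : Mat m n V)
      (C : Matrix (Fin n) (Fin l) ℂ), N k l (act A B C) ≤ opNorm A * N m n B * opNorm C) :
    MatrixSeminorm V where
  toFun := N
  nonneg := nonneg
  add_le := add_le
  act_le := act_le
  smul := by
    have key : ∀ {m n} (c : ℂ) (A : Mat m n V), N m n (c • A) ≤ ‖c‖ * N m n A := by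
      intro m n c A
      rw [← act_smul_one]
      refine (act_le _ _ _).trans ?_
      calc _ ≤ opNorm (c • (1 : Matrix (Fin m) (Fin m) ℂ)) * N m n A * 1 :=
            mul_le_mul_of_nonneg_left (opNorm_one_le n)
              (mul_nonneg (opNorm_nonneg _) (nonneg A))
        _ ≤ _ := by
            rw [mul_one]
            exact mul_le_mul_of_nonneg_right (opNorm_smul_one_le c m) (nonneg A)
    intro m n c A
    refine le_antisymm (key c A) ?_
    rcases eq_or_ne c 0 with rfl | hc
    · rw [norm_zero, zero_mul]; exact nonneg _
    · have h := key c⁻¹ (c • A)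
      rw [smul_smul, inv_mul_cancel₀ hc, one_smul, norm_inv] at h
      have hc' : 0 < ‖c‖ := norm_pos_iff.2 hc
      calc ‖c‖ * N m n A ≤ ‖c‖ * (‖c‖⁻¹ * N m n (c • A)) :=
            mul_le_mul_of_nonneg_left h hc'.le
        _ = N m n (c • A) := by rw [← mul_assoc, mul_inv_cancel₀ hc'.ne', one_mul]

namespace MatrixSeminorm

variable (N : MatrixSeminorm V)

theorem map_zero (m n : ℕ) : N.toFun m n 0 = 0 := by
  have h := N.smul (0 : ℂ) (0 : Mat m n V)
  rwa [zero_smul, norm_zero, zero_mul] at h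

theorem map_neg {m n : ℕ} (A : Mat m n V) : N.toFun m n (-A) = N.toFun m n A := by
  have h := N.smul (-1 : ℂ) A
  rwa [neg_one_smul, norm_neg, norm_one, one_mul] at h

theorem sum_le {ι : Type*} (s : Finset ι) {m n : ℕ} (A : ι → Mat m n V) :
    N.toFun m n (∑ i ∈ s, A i) ≤ ∑ i ∈ s, N.toFun m n (A i) := by
  classical
  induction s using Finset.induction_on with
  | empty => simp [N.map_zero]
  | insert a s ha ih =>
    rw [Finset.sum_insert ha, Finset.sum_insert ha]
    exact (N.add_le _ _).trans (add_le_add le_rfl ih)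

theorem act_le_of_le_one {k m n l : ℕ} {A : Matrix (Fin k) (Fin m) ℂ} (B : Mat m n V)
    {C : Matrix (Fin n) (Fin l) ℂ} (hA : opNorm A ≤ 1) (hC : opNorm C ≤ 1) :
    N.toFun k l (act A B C) ≤ N.toFun m n B := by
  refine (N.act_le A B C).trans ?_
  calc _ ≤ 1 * N.toFun m n B * 1 := mul_le_mul
        (mul_le_mul_of_nonneg_right hA (N.nonneg B)) hC (opNorm_nonneg _)
        (mul_nonneg zero_le_one (N.nonneg B))
    _ = _ := by ring

theorem entry_le {m n : ℕ} (A : Mat m n V) (i : Fin m) (j : Fin n) :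
    N.toFun 1 1 (fun _ _ => A i j) ≤ N.toFun m n A := by
  have h : (fun _ _ => A i j : Mat 1 1 V)
      = act (Matrix.single 0 i (1 : ℂ)) A (Matrix.single j 0 (1 : ℂ)) := by
    ext a b
    obtain rfl := Subsingleton.elim a 0
    obtain rfl := Subsingleton.elim b 0
    simp only [act]
    rw [Finset.sum_eq_single i, Finset.sum_eq_single j]
    · simp
    · intro b _ hb; simp [Ne.symm hb]
    · simp
    · intro a _ ha; simp [Matrix.single_apply, Ne.symm ha]
    · simp
  rw [h]
  exact N.act_le_of_le_one A (opNorm_single_le _ _) (opNorm_single_le _ _)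

theorem single_le {m n : ℕ} (v : V) (i : Fin m) (j : Fin n) :
    N.toFun m n (Pi.single i (Pi.single j v)) ≤ N.toFun 1 1 (fun _ _ => v) := by
  have h : (Pi.single i (Pi.single j v) : Mat m n V)
      = act (Matrix.single i 0 (1 : ℂ)) (fun _ _ => v : Mat 1 1 V) (Matrix.single 0 j (1 : ℂ)) := by
    ext a b
    simp only [act, Fin.sum_univ_one, Matrix.single_apply]
    by_cases ha : a = i
    · subst ha
      by_cases hb : b = j
      · subst hb; simp
      · simp [hb, Ne.symm hb]
    · simp [ha, Ne.symm ha]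
  rw [h]
  exact N.act_le_of_le_one _ (opNorm_single_le _ _) (opNorm_single_le _ _)

theorem eq_sum_single {m n : ℕ} {V : Type*} [AddCommMonoid V] (A : Mat m n V) :
    A = ∑ i, ∑ j, Pi.single i (Pi.single j (A i j)) := by
  ext a b
  simp only [Finset.sum_apply]
  rw [Finset.sum_eq_single a, Finset.sum_eq_single b]
  · simp
  · intro c _ hc; simp [Ne.symm hc]
  · simp
  · intro c _ hc; simp [Ne.symm hc]
  · simp

theorem le_sum_entries {m n : ℕ} (A : Mat m n V) :
    N.toFun m n A ≤ ∑ i, ∑ j, N.toFun 1 1 (fun _ _ => A i j) := by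
  conv_lhs => rw [eq_sum_single A]
  refine (N.sum_le _ _).trans (Finset.sum_le_sum fun i _ => ?_)
  exact (N.sum_le _ _).trans (Finset.sum_le_sum fun j _ => N.single_le _ _ _)

theorem abs_sub_le {m n : ℕ} (A B : Mat m n V) :
    |N.toFun m n A - N.toFun m n B| ≤ N.toFun m n (A - B) := by
  have h1 := N.add_le (A - B) B
  have h2 := N.add_le (B - A) A
  rw [sub_add_cancel] at h1 h2
  rw [← neg_sub A B, N.map_neg] at h2
  rw [abs_sub_le_iff]
  constructor <;> linarith

end MatrixSeminorm

/-- Each level of the matrix-norm of a matricial Banach space is a norm, not only a seminorm. -/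
theorem MBan.mat_eq_zero (V : MBan.{u}) {m n : ℕ} {A : Mat m n V} (h : V.norm A = 0) : A = 0 := by
  ext i j
  have := V.mat.entry_le A i j
  rw [V.mat_one] at this
  exact norm_le_zero_iff.1 (this.trans h.le)

end act

end MatBan

namespace MatBan

/-! ### Completion of a matrix-seminormed space -/

section completion

variable {V : Type u} [AddCommGroup V] [Module ℂ V]

/-- `V` regarded as a seminormed space with the `(1,1)` level of `N`. -/
def MatrixSeminorm.Space (_N : MatrixSeminorm V) : Type u := V

variable (N : MatrixSeminorm V)

instance : AddCommGroup N.Space := inferInstanceAs (AddCommGroup V)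

instance : Module ℂ N.Space := inferInstanceAs (Module ℂ V)

instance : Norm N.Space := ⟨fun v => N.toFun 1 1 (fun _ _ => v)⟩

instance : SeminormedAddCommGroup N.Space :=
  SeminormedAddCommGroup.ofCore (𝕜 := ℂ)
    { norm_nonneg := fun _ => N.nonneg _
      norm_smul := fun c v => N.smul c (fun _ _ => v : Mat 1 1 V)
      norm_triangle := fun v w => N.add_le (fun _ _ => v : Mat 1 1 V) (fun _ _ => w) }

instance : NormedSpace ℂ N.Space :=
  ⟨fun c v => (N.smul c (fun _ _ => v : Mat 1 1 V)).le⟩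

theorem MatrixSeminorm.norm_def (v : N.Space) : ‖v‖ = N.toFun 1 1 (fun _ _ => v) := rfl

/-- The canonical map from a seminormed matrix space to its completion. -/
def MatrixSeminorm.kappa : N.Space →ₗ[ℂ] Completion N.Space :=
  (Completion.toComplL (𝕜 := ℂ) (E := N.Space)).toLinearMap

/-- The matrix-norm on the completion: the limit of `N(B)` as the entries of `B` tend to those
of `A`. -/
def MatrixSeminorm.limNorm (m n : ℕ) (A : Mat m n (Completion N.Space)) : ℝ :=
  Filter.limUnder (Filter.comap (fun B : Mat m n N.Space => ampl N.kappa B) (𝓝 A))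
    (fun B : Mat m n N.Space => N.toFun m n B)

theorem MatrixSeminorm.denseRange_kappa (m n : ℕ) :
    DenseRange (fun B : Mat m n N.Space => ampl N.kappa B) :=
  DenseRange.piMap fun _ => DenseRange.piMap fun _ => Completion.denseRange_coe

theorem MatrixSeminorm.isUniformInducing_kappa (m n : ℕ) :
    IsUniformInducing (fun B : Mat m n N.Space => ampl N.kappa B) := by
  have h := Completion.isUniformInducing_coe N.Space
  refine ⟨?_⟩
  simp only [Pi.uniformity, Filter.comap_iInf, Filter.comap_comap]
  rw [← h.comap_uniformity]
  simp only [Filter.comap_comap]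
  rfl

theorem MatrixSeminorm.uniformContinuous (m n : ℕ) :
    UniformContinuous (fun B : Mat m n N.Space => N.toFun m n B) := by
  have h : LipschitzWith (∑ _i : Fin m, ∑ _j : Fin n, 1)
      (fun B : Mat m n N.Space => N.toFun m n B) := by
    refine LipschitzWith.of_dist_le_mul fun A B => ?_
    rw [Real.dist_eq, dist_eq_norm]
    refine (N.abs_sub_le A B).trans ((N.le_sum_entries _).trans ?_)
    push_cast
    rw [Finset.sum_mul]
    refine Finset.sum_le_sum fun i _ => ?_
    rw [Finset.sum_mul]
    refine Finset.sum_le_sum fun j _ => ?_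
    rw [one_mul]
    exact (norm_le_pi_norm ((A - B) i) j).trans (norm_le_pi_norm (A - B) i)
  exact h.uniformContinuous

theorem MatrixSeminorm.continuous_limNorm (m n : ℕ) : Continuous (N.limNorm m n) :=
  (uniformContinuous_uniformly_extend (N.isUniformInducing_kappa m n) (N.denseRange_kappa m n)
    (N.uniformContinuous m n)).continuous

theorem MatrixSeminorm.limNorm_kappa {m n : ℕ} (B : Mat m n N.Space) :
    N.limNorm m n (ampl N.kappa B) = N.toFun m n B :=
  uniformly_extend_of_ind (N.isUniformInducing_kappa m n) (N.denseRange_kappa m n)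
    (N.uniformContinuous m n) B

theorem continuous_act {W : Type*} [NormedAddCommGroup W] [NormedSpace ℂ W] {k m n l : ℕ}
    (A : Matrix (Fin k) (Fin m) ℂ) (C : Matrix (Fin n) (Fin l) ℂ) :
    Continuous (fun B : Mat m n W => act A B C) := by
  unfold act
  fun_prop

/-- The completion of a matrix-seminormed space, a matricial Banach space.  (Vectors of norm zero
are identified with zero.) -/
def MatrixSeminorm.completion : MBan.{u} where
  carrier := Completion N.Space
  mat := MatrixSeminorm.ofAct N.limNorm
    (fun {m n} A => by
      refine (N.denseRange_kappa m n).induction_on A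
        (isClosed_le continuous_const (N.continuous_limNorm m n)) fun B => ?_
      rw [N.limNorm_kappa]; exact N.nonneg _)
    (fun {m n} A B => by
      refine (N.denseRange_kappa m n).induction_on₂ (p := fun A B =>
        N.limNorm m n (A + B) ≤ N.limNorm m n A + N.limNorm m n B) ?_ (fun A B => ?_) A B
      · have h := N.continuous_limNorm m n
        exact isClosed_le (h.comp (continuous_fst.add continuous_snd))
          ((h.comp continuous_fst).add (h.comp continuous_snd))
      · have h : ampl N.kappa A + ampl N.kappa B = ampl N.kappa (A + B) := by
          ext i j; simp only [ampl, Pi.add_apply]; exact (map_add N.kappa _ _).symm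
        simp only [h, N.limNorm_kappa]
        exact N.add_le _ _)
    (fun {k m n l} A B C => by
      refine (N.denseRange_kappa m n).induction_on (p := fun B =>
        N.limNorm k l (act A B C) ≤ opNorm A * N.limNorm m n B * opNorm C) B ?_ fun B => ?_
      · exact isClosed_le ((N.continuous_limNorm k l).comp (continuous_act A C))
          ((continuous_const.mul (N.continuous_limNorm m n)).mul continuous_const)
      · have h : act A (ampl N.kappa B) C = ampl N.kappa (act A B C) :=
          (ampl_act N.kappa A B C).symm
        simp only [h, N.limNorm_kappa]
        exact N.act_le _ _ _)
  mat_one v := by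
    refine Completion.induction_on v (isClosed_eq ?_ continuous_norm) fun v => ?_
    · exact (N.continuous_limNorm 1 1).comp (continuous_pi fun _ => continuous_pi fun _ =>
        continuous_id)
    · exact (N.limNorm_kappa (fun _ _ => v : Mat 1 1 V)).trans (Completion.norm_coe v).symm

end completion

/-! ### Norms as infima over decompositions -/

section decomp

variable {ι E : Type*} [AddCommMonoid E]

/-- The infimum of `∑ cost` over all finite decompositions of `x` as a sum of atoms. -/
def decompNorm (atom : ι → E) (cost : ι → ℝ) (x : E) : ℝ :=
  sInf {r | ∃ (p : ℕ) (i : Fin p → ι), x = ∑ l, atom (i l) ∧ r = ∑ l, cost (i l)}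

variable {atom : ι → E} {cost : ι → ℝ}

theorem exists_decomp {x : E} (hx : x ∈ AddSubmonoid.closure (Set.range atom)) :
    ∃ (p : ℕ) (i : Fin p → ι), x = ∑ l, atom (i l) := by
  induction hx using AddSubmonoid.closure_induction with
  | mem x hx => obtain ⟨i, rfl⟩ := hx; exact ⟨1, fun _ => i, by simp⟩
  | zero => exact ⟨0, Fin.elim0, by simp⟩
  | add x y _ _ hx hy =>
    obtain ⟨p, i, rfl⟩ := hx
    obtain ⟨q, j, rfl⟩ := hy
    exact ⟨p + q, Fin.append i j, by simp [Fin.sum_univ_add]⟩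

theorem bddBelow_decomp (hc : ∀ i, 0 ≤ cost i) (x : E) :
    BddBelow {r | ∃ (p : ℕ) (i : Fin p → ι), x = ∑ l, atom (i l) ∧ r = ∑ l, cost (i l)} :=
  ⟨0, by rintro r ⟨p, i, -, rfl⟩; exact Finset.sum_nonneg fun l _ => hc _⟩

theorem decompNorm_nonneg (hc : ∀ i, 0 ≤ cost i) (x : E) : 0 ≤ decompNorm atom cost x :=
  Real.sInf_nonneg (by rintro r ⟨p, i, -, rfl⟩; exact Finset.sum_nonneg fun l _ => hc _)

theorem decompNorm_atom_le (hc : ∀ i, 0 ≤ cost i) (i : ι) :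
    decompNorm atom cost (atom i) ≤ cost i :=
  csInf_le (bddBelow_decomp hc _) ⟨1, fun _ => i, by simp, by simp⟩

theorem le_mul_decompNorm (hs : ∀ x, x ∈ AddSubmonoid.closure (Set.range atom))
    {g : E → ℝ} (g0 : g 0 ≤ 0) (gadd : ∀ x y, g (x + y) ≤ g x + g y) {K : ℝ} (hK : 0 ≤ K)
    (gatom : ∀ i, g (atom i) ≤ K * cost i) (x : E) : g x ≤ K * decompNorm atom cost x := by
  have main : ∀ (p : ℕ) (i : Fin p → ι), g (∑ l, atom (i l)) ≤ K * ∑ l, cost (i l) := by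
    intro p
    induction p with
    | zero => intro i; simpa using g0
    | succ p ih =>
      intro i
      rw [Fin.sum_univ_succ, Fin.sum_univ_succ, mul_add]
      exact (gadd _ _).trans (add_le_add (gatom _) (ih _))
  unfold decompNorm
  rw [← smul_eq_mul, ← Real.sInf_smul_of_nonneg hK]
  obtain ⟨p, i, hx⟩ := exists_decomp (hs x)
  refine le_csInf ⟨_, Set.smul_mem_smul_set ⟨p, i, hx, rfl⟩⟩ ?_
  rintro _ ⟨r, ⟨p, i, rfl, rfl⟩, rfl⟩
  exact main p i

theorem decompNorm_add_le (hc : ∀ i, 0 ≤ cost i)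
    (hs : ∀ x, x ∈ AddSubmonoid.closure (Set.range atom)) (x y : E) :
    decompNorm atom cost (x + y) ≤ decompNorm atom cost x + decompNorm atom cost y := by
  obtain ⟨p, i, hx⟩ := exists_decomp (hs x)
  obtain ⟨q, j, hy⟩ := exists_decomp (hs y)
  have h1 : ∀ (p : ℕ) (i : Fin p → ι), x = ∑ l, atom (i l) →
      decompNorm atom cost (x + y) - ∑ l, cost (i l) ≤ decompNorm atom cost y := by
    intro p i hx
    refine le_csInf ⟨_, q, j, hy, rfl⟩ ?_
    rintro _ ⟨q, j, hy, rfl⟩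
    have : decompNorm atom cost (x + y) ≤ ∑ l, cost (i l) + ∑ l, cost (j l) :=
      csInf_le (bddBelow_decomp hc _)
        ⟨p + q, Fin.append i j, by simp [Fin.sum_univ_add, hx, hy], by simp [Fin.sum_univ_add]⟩
    linarith
  have h2 : decompNorm atom cost (x + y) - decompNorm atom cost y ≤ decompNorm atom cost x := by
    refine le_csInf ⟨_, p, i, hx, rfl⟩ ?_
    rintro _ ⟨p, i, hx, rfl⟩
    have := h1 p i hx
    linarith
  linarith

theorem decompNorm_zero_le (hc : ∀ i, 0 ≤ cost i) : decompNorm atom cost (0 : E) ≤ 0 :=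
  csInf_le (bddBelow_decomp hc _) ⟨0, Fin.elim0, by simp, by simp⟩

theorem mem_closure_of_single {ι V : Type*} [AddCommMonoid V] {m n : ℕ} {atom : ι → Mat m n V}
    (h : ∀ i j v, (Pi.single i (Pi.single j v) : Mat m n V) ∈
      AddSubmonoid.closure (Set.range atom)) (A : Mat m n V) :
    A ∈ AddSubmonoid.closure (Set.range atom) := by
  rw [MatrixSeminorm.eq_sum_single A]
  exact sum_mem fun i _ => sum_mem fun j _ => h i j _

end decomp

/-! ### The absolute maximum matrix-norm -/

section amax

variable (V : Type u) [NormedAddCommGroup V] [NormedSpace ℂ V]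

/-- `v ⊗ C`, the array with entries `C(i,j) v`. -/
def elemTensor {V : Type*} [AddCommGroup V] [Module ℂ V] {m n : ℕ} (v : V)
    (C : Matrix (Fin m) (Fin n) ℂ) : Mat m n V := fun i j => C i j • v

/-- The projective tensor norm: the infimum of `∑ ‖v_l‖ ‖C_l‖_{tr}` over all representations
`A = ∑ v_l ⊗ C_l`. -/
def amaxNorm (m n : ℕ) (A : Mat m n V) : ℝ :=
  decompNorm (fun a : V × Matrix (Fin m) (Fin n) ℂ => elemTensor a.1 a.2)
    (fun a => ‖a.1‖ * traceNorm a.2) A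

variable {V}

theorem amax_cost_nonneg {V : Type*} [NormedAddCommGroup V] {m n : ℕ} (a : V × Matrix (Fin m) (Fin n) ℂ) :
    0 ≤ ‖a.1‖ * traceNorm a.2 := mul_nonneg (norm_nonneg _) (traceNorm_nonneg _)

theorem amax_span {m n : ℕ} (A : Mat m n V) : A ∈ AddSubmonoid.closure
    (Set.range fun a : V × Matrix (Fin m) (Fin n) ℂ => elemTensor a.1 a.2) := by
  refine mem_closure_of_single (fun i j v => AddSubmonoid.subset_closure ?_) A
  refine ⟨(v, Matrix.single i j 1), ?_⟩
  ext a b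
  simp only [elemTensor, Matrix.single_apply]
  by_cases ha : a = i
  · subst ha
    by_cases hb : b = j
    · subst hb; simp
    · simp [hb, Ne.symm hb]
  · simp [ha, Ne.symm ha]

theorem act_elemTensor {k m n l : ℕ} (A : Matrix (Fin k) (Fin m) ℂ) (v : V)
    (D : Matrix (Fin m) (Fin n) ℂ) (C : Matrix (Fin n) (Fin l) ℂ) :
    act A (elemTensor v D) C = elemTensor v (A * D * C) := by
  ext i j
  simp only [act, elemTensor, smul_smul, ← Finset.sum_smul, Matrix.mul_apply, Finset.sum_mul]
  rw [Finset.sum_comm]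
  congr 1
  exact Finset.sum_congr rfl fun b _ => Finset.sum_congr rfl fun a _ => by ring

variable (V)

/-- `AMAX(V)`: the Banach space `V` with the absolute maximum matrix-norm. -/
def AMAX [CompleteSpace V] : MBan.{u} where
  carrier := V
  mat := MatrixSeminorm.ofAct (amaxNorm V)
    (fun A => decompNorm_nonneg amax_cost_nonneg A)
    (fun A B => decompNorm_add_le amax_cost_nonneg amax_span A B)
    (fun {k m n l} A B C => by
      have h := le_mul_decompNorm (cost := fun a : V × Matrix (Fin m) (Fin n) ℂ =>
        ‖a.1‖ * traceNorm a.2) amax_span (g := fun B => amaxNorm V k l (act A B C))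
        (by rw [act_zero]; exact decompNorm_zero_le amax_cost_nonneg)
        (fun x y => by rw [act_add]; exact decompNorm_add_le amax_cost_nonneg amax_span _ _)
        (mul_nonneg (opNorm_nonneg A) (opNorm_nonneg C))
        (fun a => by
          rw [act_elemTensor]
          refine (decompNorm_atom_le amax_cost_nonneg (a.1, A * a.2 * C)).trans ?_
          calc ‖a.1‖ * traceNorm (A * a.2 * C)
              ≤ ‖a.1‖ * (opNorm A * traceNorm a.2 * opNorm C) :=
                mul_le_mul_of_nonneg_left (traceNorm_mul_mul_le _ _ _) (norm_nonneg _)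
            _ = _ := by ring) B
      calc _ ≤ _ := h
        _ = _ := by unfold amaxNorm; ring)
  mat_one v := by
    change amaxNorm V 1 1 (fun _ _ => v) = ‖v‖
    apply le_antisymm
    · have h : (fun _ _ => v : Mat 1 1 V) = elemTensor v (1 : Matrix (Fin 1) (Fin 1) ℂ) := by
        ext i j
        obtain rfl := Subsingleton.elim i 0
        obtain rfl := Subsingleton.elim j 0
        simp [elemTensor]
      rw [h]
      refine (decompNorm_atom_le amax_cost_nonneg (v, 1)).trans ?_
      refine mul_le_of_le_one_right (norm_nonneg v) (traceNorm_le _ zero_le_one fun B => ?_)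
      rw [one_mul, one_mul]
      have hB : B = Matrix.diagonal fun _ => B 0 0 := by
        ext i j
        obtain rfl := Subsingleton.elim i 0
        obtain rfl := Subsingleton.elim j 0
        simp
      have hB' : opNorm B = ‖fun _ : Fin 1 => B 0 0‖ := by
        conv_lhs => rw [hB]
        exact Matrix.l2_opNorm_diagonal _
      rw [hB', Matrix.trace, Fin.sum_univ_one]
      exact norm_le_pi_norm (fun _ : Fin 1 => B 0 0) 0
    · have h := le_mul_decompNorm (cost := fun a : V × Matrix (Fin 1) (Fin 1) ℂ =>
        ‖a.1‖ * traceNorm a.2) amax_span (g := fun B => ‖B 0 0‖) (by simp)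
        (fun x y => norm_add_le _ _) zero_le_one
        (fun a => by
          simp only [elemTensor, norm_smul, one_mul]
          rw [mul_comm]
          refine mul_le_mul_of_nonneg_left ?_ (norm_nonneg _)
          have h := norm_trace_le a.2 1
          rw [mul_one] at h
          have h2 : a.2.trace = a.2 0 0 := by simp [Matrix.trace]
          rw [h2] at h
          exact h.trans (mul_le_of_le_one_right (traceNorm_nonneg _) (opNorm_one_le 1)))
        (fun _ _ => v : Mat 1 1 V)
      rw [one_mul] at h
      exact h

end amax

end MatBan

namespace MatBan

/-! ### The Haagerup tensor product -/

section haagerup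

/-- The matrix product of arrays with respect to a product `φ` of the entries. -/
def matMul {S T U : Type*} [AddCommMonoid U] (φ : S → T → U) {m p n : ℕ} (A : Mat m p S)
    (B : Mat p n T) : Mat m n U :=
  fun i k => ∑ j, φ (A i j) (B j k)

variable (V W : MBan.{u})

/-- `A ⊙ B`, for `A ∈ M_{m,q}(V)` and `B ∈ M_{q,n}(W)` with arbitrary `q`. -/
def haagAtom (m n : ℕ) (a : Σ q : ℕ, Mat m q V × Mat q n W) : Mat m n (V ⊗[ℂ] W) :=
  matMul (fun v w => v ⊗ₜ[ℂ] w) a.2.1 a.2.2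

/-- `‖A‖ ‖B‖`. -/
def haagCost (m n : ℕ) (a : Σ q : ℕ, Mat m q V × Mat q n W) : ℝ :=
  V.norm a.2.1 * W.norm a.2.2

variable {V W}

theorem haagCost_nonneg {m n : ℕ} (a : Σ q : ℕ, Mat m q V × Mat q n W) :
    0 ≤ haagCost V W m n a := mul_nonneg (V.mat.nonneg _) (W.mat.nonneg _)

theorem haag_span {m n : ℕ} (C : Mat m n (V ⊗[ℂ] W)) :
    C ∈ AddSubmonoid.closure (Set.range (haagAtom V W m n)) := by
  refine mem_closure_of_single (fun i j t => ?_) C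
  induction t using TensorProduct.induction_on with
  | zero => simp
  | add x y hx hy => rw [Pi.single_add, Pi.single_add]; exact add_mem hx hy
  | tmul v w =>
    refine AddSubmonoid.subset_closure ⟨⟨1, fun a _ => if a = i then v else 0,
      fun _ b => if b = j then w else 0⟩, ?_⟩
    ext a b
    simp only [haagAtom, matMul, Fin.sum_univ_one]
    by_cases ha : a = i
    · subst ha
      by_cases hb : b = j
      · subst hb; simp
      · simp [hb]
    · simp [ha]

theorem act_one_right {V : Type*} [AddCommGroup V] [Module ℂ V] {k m n : ℕ}
    (A : Matrix (Fin k) (Fin m) ℂ) (X : Mat m n V) (i : Fin k) (j : Fin n) :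
    act A X 1 i j = ∑ a, A i a • X a j := by
  refine Finset.sum_congr rfl fun a _ => ?_
  rw [Finset.sum_eq_single j]
  · simp
  · intro b _ hb; simp [hb]
  · simp

theorem act_one_left {V : Type*} [AddCommGroup V] [Module ℂ V] {m n l : ℕ}
    (X : Mat m n V) (C : Matrix (Fin n) (Fin l) ℂ) (i : Fin m) (j : Fin l) :
    act 1 X C i j = ∑ b, C b j • X i b := by
  unfold act
  rw [Finset.sum_eq_single i]
  · simp
  · intro b _ hb; simp [Ne.symm hb]
  · simp

theorem act_haagAtom {k m n l : ℕ} (A : Matrix (Fin k) (Fin m) ℂ)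
    (a : Σ q : ℕ, Mat m q V × Mat q n W) (C : Matrix (Fin n) (Fin l) ℂ) :
    act A (haagAtom V W m n a) C
      = haagAtom V W k l ⟨a.1, act A a.2.1 1, act 1 a.2.2 C⟩ := by
  ext i j
  simp only [haagAtom, matMul, act_one_right, act_one_left, TensorProduct.sum_tmul,
    TensorProduct.tmul_sum]
  have h : act A (fun i k => ∑ q, a.2.1 i q ⊗ₜ[ℂ] a.2.2 q k : Mat m n (V ⊗[ℂ] W)) C i j
      = ∑ c, ∑ b, ∑ q, (A i c * C b j) • (a.2.1 c q ⊗ₜ[ℂ] a.2.2 q b) := by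
    simp only [act, Finset.smul_sum]
  refine h.trans ?_
  rw [Finset.sum_comm]
  refine (Finset.sum_congr rfl fun b _ => Finset.sum_comm).trans ?_
  rw [Finset.sum_comm]
  refine Finset.sum_congr rfl fun q _ => Finset.sum_congr rfl fun b _ =>
    Finset.sum_congr rfl fun c _ => ?_
  rw [TensorProduct.smul_tmul_smul]

variable (V W)

/-- The Haagerup matrix-norm on `V ⊗ W`: the infimum of `∑ ‖A_l‖ ‖B_l‖` over all representations
`C = ∑ A_l ⊙ B_l`. -/
def haagNorm : MatrixSeminorm (V ⊗[ℂ] W) :=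
  MatrixSeminorm.ofAct (fun m n C => decompNorm (haagAtom V W m n) (haagCost V W m n) C)
    (fun C => decompNorm_nonneg haagCost_nonneg C)
    (fun C D => decompNorm_add_le haagCost_nonneg haag_span C D)
    (fun {k m n l} A B C => by
      have h := le_mul_decompNorm (cost := haagCost V W m n) haag_span
        (g := fun B => decompNorm (haagAtom V W k l) (haagCost V W k l) (act A B C))
        (by rw [act_zero]; exact decompNorm_zero_le haagCost_nonneg)
        (fun x y => by rw [act_add]; exact decompNorm_add_le haagCost_nonneg haag_span _ _)
        (mul_nonneg (opNorm_nonneg A) (opNorm_nonneg C))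
        (fun a => by
          rw [act_haagAtom]
          refine (decompNorm_atom_le haagCost_nonneg _).trans ?_
          have h1 : V.norm (act A a.2.1 1) ≤ opNorm A * V.norm a.2.1 :=
            (V.mat.act_le _ _ _).trans (mul_le_of_le_one_right
              (mul_nonneg (opNorm_nonneg _) (V.mat.nonneg _)) (opNorm_one_le _))
          have h2 : W.norm (act 1 a.2.2 C) ≤ W.norm a.2.2 * opNorm C :=
            (W.mat.act_le _ _ _).trans (mul_le_mul_of_nonneg_right
              (mul_le_of_le_one_left (W.mat.nonneg _) (opNorm_one_le _)) (opNorm_nonneg _))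
          calc V.norm (act A a.2.1 1) * W.norm (act 1 a.2.2 C)
              ≤ (opNorm A * V.norm a.2.1) * (W.norm a.2.2 * opNorm C) :=
                mul_le_mul h1 h2 (W.mat.nonneg _)
                  (mul_nonneg (opNorm_nonneg _) (V.mat.nonneg _))
            _ = opNorm A * opNorm C * (V.norm a.2.1 * W.norm a.2.2) := by ring) B
      calc _ ≤ _ := h
        _ = _ := by ring)

/-- The Haagerup tensor product `V ⊗_h W`. -/
def haag : MBan.{u} := (haagNorm V W).completion

/-- The canonical map from the algebraic tensor product to `V ⊗_h W`. -/
def haagIncl : V ⊗[ℂ] W →ₗ[ℂ] haag V W := (haagNorm V W).kappa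

/-- The elementary tensors `v ⊗ w` in `V ⊗_h W`. -/
def haagMk : V →ₗ[ℂ] W →ₗ[ℂ] haag V W :=
  (TensorProduct.mk ℂ V W).compr₂ (haagIncl V W)

variable {V W}

theorem haag_norm_incl {m n : ℕ} (C : Mat m n (V ⊗[ℂ] W)) :
    (haag V W).norm (ampl (haagIncl V W) C) = (haagNorm V W).toFun m n C :=
  (haagNorm V W).limNorm_kappa C

theorem haag_continuous_norm (m n : ℕ) :
    Continuous fun C : Mat m n (haag V W) => (haag V W).norm C :=
  (haagNorm V W).continuous_limNorm m n

theorem haag_denseRange (m n : ℕ) :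
    DenseRange fun C : Mat m n (V ⊗[ℂ] W) => ampl (haagIncl V W) C :=
  (haagNorm V W).denseRange_kappa m n

theorem haag_norm_matMul_le {m p n : ℕ} (A : Mat m p V) (B : Mat p n W) :
    (haag V W).norm (matMul (fun v w => haagMk V W v w) A B) ≤ V.norm A * W.norm B := by
  have h : matMul (fun v w => haagMk V W v w) A B
      = ampl (haagIncl V W) (haagAtom V W m n ⟨p, A, B⟩) := by
    ext i k; simp [matMul, ampl, haagAtom, haagMk, map_sum]
  rw [h, haag_norm_incl]
  exact decompNorm_atom_le haagCost_nonneg (⟨p, A, B⟩ : Σ q : ℕ, Mat m q V × Mat q n W)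

/-- A bilinear map is completely contractive if it is contractive for all matrix products. -/
def BilinCC {P Q R : MBan.{u}} (φ : P →ₗ[ℂ] Q →ₗ[ℂ] R) : Prop :=
  ∀ (m p n : ℕ) (A : Mat m p P) (B : Mat p n Q),
    R.norm (matMul (fun v w => φ v w) A B) ≤ P.norm A * Q.norm B

variable {P Q R : MBan.{u}}

/-- For `a ∈ P`, the map `b ⊗ v ↦ φ(a, b) ⊗ v` on the algebraic tensor product. -/
def stepAux (φ : P →ₗ[ℂ] Q →ₗ[ℂ] R) (V : MBan.{u}) : P →ₗ[ℂ] Q ⊗[ℂ] V →ₗ[ℂ] haag R V :=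
  (TensorProduct.lift.equiv (RingHom.id ℂ) Q V (haag R V)).toLinearMap ∘ₗ
    (LinearMap.llcomp ℂ Q R (V →ₗ[ℂ] haag R V) (haagMk R V)) ∘ₗ φ

theorem stepAux_tmul (φ : P →ₗ[ℂ] Q →ₗ[ℂ] R) (V : MBan.{u}) (a : P) (b : Q) (v : V) :
    stepAux φ V a (b ⊗ₜ v) = haagMk R V (φ a b) v := by
  simp [stepAux]

theorem stepAux_le {φ : P →ₗ[ℂ] Q →ₗ[ℂ] R} (hφ : BilinCC φ) {V : MBan.{u}} {m p n : ℕ}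
    (A : Mat m p P) (B : Mat p n (Q ⊗[ℂ] V)) :
    (haag R V).norm (matMul (fun a t => stepAux φ V a t) A B)
      ≤ P.norm A * (haagNorm Q V).toFun p n B := by
  refine le_mul_decompNorm (cost := haagCost Q V p n) haag_span
    (g := fun B => (haag R V).norm (matMul (fun a t => stepAux φ V a t) A B)) ?_ ?_
    (P.mat.nonneg A) ?_ B
  · have h : matMul (fun a t => stepAux φ V a t) A (0 : Mat p n (Q ⊗[ℂ] V)) = 0 := by
      ext i k; simp [matMul]
    rw [h]; exact ((haag R V).mat.map_zero m n).le
  · intro x y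
    have h : matMul (fun a t => stepAux φ V a t) A (x + y)
        = matMul (fun a t => stepAux φ V a t) A x + matMul (fun a t => stepAux φ V a t) A y := by
      ext i k; simp [matMul, Finset.sum_add_distrib]
    rw [h]; exact (haag R V).mat.add_le _ _
  · rintro ⟨q, X, Y⟩
    have h : matMul (fun a t => stepAux φ V a t) A (haagAtom Q V p n ⟨q, X, Y⟩)
        = matMul (fun r v => haagMk R V r v) (matMul (fun a b => φ a b) A X) Y := by
      ext i k
      simp only [matMul, haagAtom, map_sum, stepAux_tmul, LinearMap.sum_apply]
      exact Finset.sum_comm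
    rw [h]
    refine (haag_norm_matMul_le _ _).trans ?_
    calc _ ≤ (P.norm A * Q.norm X) * V.norm Y :=
          mul_le_mul_of_nonneg_right (hφ _ _ _ A X) (V.mat.nonneg Y)
      _ = _ := by simp only [haagCost]; ring

theorem stepAux_le_one {φ : P →ₗ[ℂ] Q →ₗ[ℂ] R} (hφ : BilinCC φ) {V : MBan.{u}}
    (a : P) (t : (haagNorm Q V).Space) : ‖stepAux φ V a t‖ ≤ ‖a‖ * ‖t‖ := by
  have h := stepAux_le hφ (V := V) (fun _ _ => a : Mat 1 1 P) (fun _ _ => t : Mat 1 1 (Q ⊗[ℂ] V))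
  have h1 : P.norm (fun _ _ => a : Mat 1 1 P) = ‖a‖ := P.mat_one a
  have h2 : matMul (fun a t => stepAux φ V a t) (fun _ _ => a : Mat 1 1 P)
      (fun _ _ => t : Mat 1 1 (Q ⊗[ℂ] V)) = fun _ _ => stepAux φ V a t := by
    ext i k; simp [matMul]
  have h3 : (haag R V).norm (fun _ _ => stepAux φ V a t : Mat 1 1 (haag R V))
      = ‖stepAux φ V a t‖ := (haag R V).mat_one _
  rw [h1, h2, h3] at h
  exact h

/-- The continuous extension of `b ⊗ v ↦ φ(a, b) ⊗ v` to `Q ⊗_h V`. -/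
def stepExt {φ : P →ₗ[ℂ] Q →ₗ[ℂ] R} (hφ : BilinCC φ) (V : MBan.{u}) (a : P) :
    haag Q V →L[ℂ] haag R V :=
  ContinuousLinearMap.extend
    (LinearMap.mkContinuous (E := (haagNorm Q V).Space) (stepAux φ V a) ‖a‖ (stepAux_le_one hφ a))
    (Completion.toComplL (𝕜 := ℂ) (E := (haagNorm Q V).Space))

theorem stepExt_incl {φ : P →ₗ[ℂ] Q →ₗ[ℂ] R} (hφ : BilinCC φ) (V : MBan.{u}) (a : P)
    (t : Q ⊗[ℂ] V) : stepExt hφ V a (haagIncl Q V t) = stepAux φ V a t :=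
  ContinuousLinearMap.extend_eq _ (e := Completion.toComplL (𝕜 := ℂ) (E := (haagNorm Q V).Space))
    Completion.denseRange_coe (Completion.isUniformInducing_coe _) t

theorem haag_induction {p : haag Q V → Prop} (hp : IsClosed {x | p x})
    (h : ∀ t : Q ⊗[ℂ] V, p (haagIncl Q V t)) (x : haag Q V) : p x :=
  Completion.induction_on (α := (haagNorm Q V).Space) x hp h

theorem stepExt_add {φ : P →ₗ[ℂ] Q →ₗ[ℂ] R} (hφ : BilinCC φ) (V : MBan.{u}) (a a' : P) :
    stepExt hφ V (a + a') = stepExt hφ V a + stepExt hφ V a' := by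
  ext x
  refine haag_induction (p := fun x => stepExt hφ V (a + a') x
    = (stepExt hφ V a + stepExt hφ V a') x)
    (isClosed_eq (ContinuousLinearMap.continuous _) (ContinuousLinearMap.continuous _))
    (fun t => ?_) x
  rw [add_apply, stepExt_incl, stepExt_incl, stepExt_incl, map_add,
    LinearMap.add_apply]

theorem stepExt_smul {φ : P →ₗ[ℂ] Q →ₗ[ℂ] R} (hφ : BilinCC φ) (V : MBan.{u}) (c : ℂ) (a : P) :
    stepExt hφ V (c • a) = c • stepExt hφ V a := by
  ext x
  refine haag_induction (p := fun x => stepExt hφ V (c • a) x = (c • stepExt hφ V a) x)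
    (isClosed_eq (ContinuousLinearMap.continuous _) (ContinuousLinearMap.continuous _))
    (fun t => ?_) x
  rw [smul_apply, stepExt_incl, stepExt_incl, map_smul, LinearMap.smul_apply]

/-- The bilinear map `(a, b ⊗ v) ↦ φ(a, b) ⊗ v`. -/
def step {φ : P →ₗ[ℂ] Q →ₗ[ℂ] R} (hφ : BilinCC φ) (V : MBan.{u}) :
    P →ₗ[ℂ] haag Q V →ₗ[ℂ] haag R V where
  toFun a := (stepExt hφ V a).toLinearMap
  map_add' a a' := by rw [stepExt_add]; rfl
  map_smul' c a := by rw [stepExt_smul]; rfl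

theorem step_cc {φ : P →ₗ[ℂ] Q →ₗ[ℂ] R} (hφ : BilinCC φ) (V : MBan.{u}) :
    BilinCC (step hφ V) := by
  intro m p n A B
  refine (haag_denseRange p n).induction_on (p := fun B =>
    (haag R V).norm (matMul (fun v w => step hφ V v w) A B) ≤ P.norm A * (haag Q V).norm B) B ?_
    fun B => ?_
  · refine isClosed_le ((haag_continuous_norm m n).comp ?_)
      (continuous_const.mul (haag_continuous_norm p n))
    refine continuous_pi fun i => continuous_pi fun k => continuous_finsetSum _ fun j _ => ?_
    exact (stepExt hφ V (A i j)).continuous.comp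
      ((continuous_apply k).comp (continuous_apply j))
  · have h : matMul (fun v w => step hφ V v w) A (ampl (haagIncl Q V) B)
        = matMul (fun a t => stepAux φ V a t) A B := by
      ext i k
      exact Finset.sum_congr rfl fun j _ => stepExt_incl hφ V _ _
    rw [h, haag_norm_incl]
    exact stepAux_le hφ A B

end haagerup

/-! ### The matricial `ℓ¹`-direct sum -/

section ellOne

theorem lp_one_norm {Λ : Type} (V : Λ → MBan.{u}) (x : lp (fun i => (V i : Type u)) 1) :
    HasSum (fun i => ‖x i‖) ‖x‖ := by
  simpa using lp.hasSum_norm (by simp) x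

/-- `∑_λ ‖M_{m,n}(π_λ)(A)‖`. -/
def sumNorm {Λ : Type} (V : Λ → MBan.{u}) (m n : ℕ) (A : Mat m n (lp (fun i => (V i : Type u)) 1)) :
    ℝ := ∑' i, (V i).norm (ampl (fun x => x i) A)

theorem summable_sumNorm {Λ : Type} (V : Λ → MBan.{u}) {m n : ℕ}
    (A : Mat m n (lp (fun i => (V i : Type u)) 1)) :
    Summable fun i => (V i).norm (ampl (fun x => x i) A) := by
  refine Summable.of_nonneg_of_le (fun i => (V i).mat.nonneg _)
    (fun i => (V i).mat.le_sum_entries _) ?_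
  refine summable_sum fun j _ => summable_sum fun k _ => ?_
  simp only [MBan.mat_one]
  exact (lp_one_norm V (A j k)).summable

/-- The matricial `ℓ¹`-direct sum of matricial Banach spaces. -/
def ellOneSum {Λ : Type} (V : Λ → MBan.{u}) : MBan.{u} where
  carrier := lp (fun i => (V i : Type u)) 1
  mat := MatrixSeminorm.ofAct (sumNorm V)
    (fun A => tsum_nonneg fun i => (V i).mat.nonneg _)
    (fun A B => by
      rw [sumNorm, sumNorm, sumNorm,
        ← (summable_sumNorm V A).tsum_add (summable_sumNorm V B)]
      exact (summable_sumNorm V (A + B)).tsum_le_tsum (fun i => (V i).mat.add_le _ _)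
        ((summable_sumNorm V A).add (summable_sumNorm V B)))
    (fun A B C => by
      rw [sumNorm, sumNorm, ← tsum_mul_left, ← tsum_mul_right]
      refine (summable_sumNorm V _).tsum_le_tsum (fun i => ?_)
        (((summable_sumNorm V B).mul_left _).mul_right _)
      have h : ampl (fun x : lp (fun i => (V i : Type u)) 1 => x i) (act A B C)
          = act A (ampl (fun x : lp (fun i => (V i : Type u)) 1 => x i) B) C :=
        ampl_act (lp.evalₗ (𝕜 := ℂ) (fun i => (V i : Type u)) 1 i) A B C
      rw [h]
      exact (V i).mat.act_le _ _ _)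
  mat_one v := by
    have h : ∀ i, (V i).norm (ampl (fun x : lp (fun i => (V i : Type u)) 1 => x i)
        (fun _ _ => v : Mat 1 1 _)) = ‖v i‖ := fun i => (V i).mat_one (v i)
    change ∑' i, _ = _
    simp only [h]
    exact (lp_one_norm V v).tsum_eq

end ellOne

end MatBan

namespace MatBan

/-! ### Matricial Banach algebras -/

/-- A matricial Banach space with a product on its elements. -/
structure MBanMul extends MBan.{u} where
  mul : carrier → carrier → carrier

/-- The axioms of a matricial Banach algebra (not necessarily unital): the product is bilinear and
associative, and the matrix-norm is submultiplicative for products of rectangular matrices. -/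
structure IsMBanAlg (A : MBanMul.{u}) : Prop where
  add_mul : ∀ x y z : A.carrier, A.mul (x + y) z = A.mul x z + A.mul y z
  mul_add : ∀ x y z : A.carrier, A.mul x (y + z) = A.mul x y + A.mul x z
  smul_mul : ∀ (c : ℂ) (x y : A.carrier), A.mul (c • x) y = c • A.mul x y
  mul_smul : ∀ (c : ℂ) (x y : A.carrier), A.mul x (c • y) = c • A.mul x y
  mul_assoc : ∀ x y z : A.carrier, A.mul (A.mul x y) z = A.mul x (A.mul y z)
  norm_matMul_le : ∀ (m p n : ℕ) (M : Mat m p A.carrier) (N : Mat p n A.carrier),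
    A.norm (matMul A.mul M N) ≤ A.norm M * A.norm N

/-- `A ≅ B` as matricial Banach algebras, with completely contractive algebra homomorphisms in both
directions: both are matricial Banach algebras and there is a completely isometric algebra
isomorphism between them. -/
def MBanAlgIso (A : MBanMul.{u}) (B : MBanMul) : Prop :=
  IsMBanAlg A ∧ IsMBanAlg B ∧ ∃ φ : A.carrier ≃ₗ[ℂ] B.carrier,
    (∀ x y, φ (A.mul x y) = B.mul (φ x) (φ y)) ∧
    ∀ (m n : ℕ) (M : Mat m n A.carrier), B.norm (ampl φ M) = A.norm M

/-- The zero algebra `{0}`. -/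
def zeroAlg : MBanMul.{0} where
  carrier := PUnit
  mat := MatrixSeminorm.ofAct (fun _ _ _ => 0) (fun _ => le_rfl) (fun _ _ => by simp)
    (fun _ _ _ => by simp)
  mat_one v := (norm_eq_zero.2 (Subsingleton.elim v 0)).symm
  mul _ _ := 0

/-- `AMAX(A)` for a Banach algebra `A` with product `mul`. -/
def amaxAlg (A : Type u) [NormedAddCommGroup A] [NormedSpace ℂ A] [CompleteSpace A]
    (mul : A → A → A) : MBanMul.{u} where
  toMBan := AMAX A
  mul := mul

/-- The Banach space `ℓ¹` of absolutely summable complex sequences `(x_n)`, `n = 1, 2, 3, …`. -/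
abbrev EllOne : Type := lp (fun _ : ℕ+ => ℂ) 1

theorem summable_convolution (x y : EllOne) :
    Summable fun n : ℕ+ => ‖∑ k ∈ Finset.Iio n, x k * y (n - k)‖ := by
  have hx : Summable fun k => ‖x k‖ := by simpa using (lp.hasSum_norm (by simp) x).summable
  have hy : Summable fun k => ‖y k‖ := by simpa using (lp.hasSum_norm (by simp) y).summable
  have hxy : Summable fun p : ℕ+ × ℕ+ => ‖x p.1‖ * ‖y p.2‖ :=
    hx.mul_of_nonneg hy (fun _ => norm_nonneg _) (fun _ => norm_nonneg _)
  have hinj : Function.Injective (fun s : (n : ℕ+) × Finset.Iio n => ((s.2 : ℕ+), s.1 - s.2)) := by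
    rintro ⟨n, k, hk⟩ ⟨n', k', hk'⟩ h
    simp only [Prod.mk.injEq] at h
    obtain ⟨rfl, h⟩ := h
    rw [Finset.mem_Iio] at hk hk'
    have : n = n' := by rw [← PNat.add_sub_of_lt hk, h, PNat.add_sub_of_lt hk']
    subst this
    rfl
  refine Summable.of_nonneg_of_le (fun _ => norm_nonneg _) (fun n => ?_)
    (hxy.comp_injective hinj).sigma
  rw [tsum_fintype]
  simp only [Function.comp_apply]
  rw [Finset.sum_coe_sort (Finset.Iio n) (fun k => ‖x k‖ * ‖y (n - k)‖)]
  exact (norm_sum_le _ _).trans (Finset.sum_le_sum fun k _ => (norm_mul _ _).le)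

/-- Convolution on `ℓ¹`: `(x * y)_n = ∑_{k < n} x_k y_{n-k}`, so that `δ_j * δ_k = δ_{j+k}`. -/
def convolution (x y : EllOne) : EllOne :=
  ⟨fun n => ∑ k ∈ Finset.Iio n, x k * y (n - k),
    memℓp_gen (by simpa using summable_convolution x y)⟩

/-! ### The Haagerup tensor algebra -/

/-- `hpow V n` is the Haagerup tensor power `V^{⊗_h (n+1)}`. -/
def hpow (V : MBan.{u}) : ℕ → MBan.{u}
  | 0 => V
  | n + 1 => haag (hpow V n) V

/-- The canonical map `V^{⊗_h (i+1)} × V^{⊗_h (j+1)} → V^{⊗_h (i+j+2)}`, by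
`(a, v) ↦ a ⊗ v` for `j = 0` and `(a, b ⊗ v) ↦ (a · b) ⊗ v` for the successor. -/
def hmul (V : MBan.{u}) (i : ℕ) : (j : ℕ) →
    {φ : hpow V i →ₗ[ℂ] hpow V j →ₗ[ℂ] hpow V (i + j + 1) // BilinCC φ}
  | 0 => ⟨haagMk (hpow V i) V, fun _ _ _ A B => haag_norm_matMul_le A B⟩
  | j + 1 => ⟨step (hmul V i j).2 V, step_cc (hmul V i j).2 V⟩

/-- The Haagerup tensor algebra `T_h(V)`: the matricial `ℓ¹`-direct sum of the Haagerup tensor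
powers of `V` with the tensor multiplication. -/
def haagTensorAlg (V : MBan.{u}) : MBanMul.{u} where
  toMBan := ellOneSum (hpow V)
  mul x y := ∑' p : ℕ × ℕ,
    (lp.single 1 (p.1 + p.2 + 1) ((hmul V p.1 p.2).1 (x.1 p.1) (y.1 p.2)) :
      lp (fun i => (hpow V i : Type u)) 1)

/-- The series defining the product of `T_h(V)` converges absolutely. -/
theorem haagTensorAlg_summable (V : MBan.{u}) (x y : lp (fun i => (hpow V i : Type u)) 1) :
    Summable fun p : ℕ × ℕ =>
      (lp.single 1 (p.1 + p.2 + 1) ((hmul V p.1 p.2).1 (x p.1) (y p.2)) :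
        lp (fun i => (hpow V i : Type u)) 1) := by
  refine Summable.of_norm_bounded ((lp_one_norm (hpow V) x).summable.mul_of_nonneg
    (lp_one_norm (hpow V) y).summable (fun _ => norm_nonneg _) (fun _ => norm_nonneg _))
    fun p => ?_
  rw [lp.norm_single (by simp)]
  have h := (hmul V p.1 p.2).2 1 1 1 (fun _ _ => x p.1) (fun _ _ => y p.2)
  have h1 : matMul (fun v w => (hmul V p.1 p.2).1 v w) (fun _ _ => x p.1 : Mat 1 1 _)
      (fun _ _ => y p.2 : Mat 1 1 _) = fun _ _ => (hmul V p.1 p.2).1 (x p.1) (y p.2) := by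
    ext i k; simp [matMul]
  have h2 : (hpow V (p.1 + p.2 + 1)).norm
      (fun _ _ => (hmul V p.1 p.2).1 (x p.1) (y p.2) : Mat 1 1 _)
      = ‖(hmul V p.1 p.2).1 (x p.1) (y p.2)‖ := MBan.mat_one _ _
  have h3 : (hpow V p.1).norm (fun _ _ => x p.1 : Mat 1 1 _) = ‖x p.1‖ := MBan.mat_one _ _
  have h4 : (hpow V p.2).norm (fun _ _ => y p.2 : Mat 1 1 _) = ‖y p.2‖ := MBan.mat_one _ _
  rw [h1, h2, h3, h4] at h
  exact h

/-! ### Array-weighted sets -/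

/-- An array-weight on `X`.  Only the values for `m, n ≥ 1` are meaningful. -/
structure ArrayWeight (X : Type u) where
  toFun : ∀ m n : ℕ, Mat m n X → ℝ
  nonneg : ∀ {m n : ℕ}, 0 < m → 0 < n → ∀ A : Mat m n X, 0 ≤ toFun m n A
  subarray_le : ∀ {j k m n : ℕ}, 0 < j → 0 < k → ∀ (A : Mat m n X) (α : Fin j → Fin m)
    (β : Fin k → Fin n), α.Injective → β.Injective →
      toFun j k (fun a b => A (α a) (β b)) ≤ toFun m n A
  rows_le : ∀ {j j' m n : ℕ}, 0 < j → 0 < j' → 0 < n → j + j' = m → ∀ (A : Mat m n X)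
    (α : Fin j → Fin m) (γ : Fin j' → Fin m), α.Injective → γ.Injective →
      Disjoint (Set.range α) (Set.range γ) →
      toFun m n A ≤ toFun j n (fun a b => A (α a) b) + toFun j' n (fun a b => A (γ a) b)
  cols_le : ∀ {k k' m n : ℕ}, 0 < k → 0 < k' → 0 < m → k + k' = n → ∀ (A : Mat m n X)
    (β : Fin k → Fin n) (δ : Fin k' → Fin n), β.Injective → δ.Injective →
      Disjoint (Set.range β) (Set.range δ) →
      toFun m n A ≤ toFun m k (fun a b => A a (β b)) + toFun m k' (fun a b => A a (δ b))

/-- The bounded range number: the infimum of `w_{m,n}(A) / √(m n)` over all `m, n ≥ 1` and all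
`A ∈ M_{m,n}(X)`. -/
def brn {X : Type u} (w : ArrayWeight X) : ℝ :=
  sInf {r | ∃ (m n : ℕ) (A : Mat m n X), 0 < m ∧ 0 < n ∧
    r = w.toFun m n A / Real.sqrt ((m : ℝ) * n)}

/-- A function `f` from an array-weighted set to a set with norm functions `N` on its arrays is
completely contractive. -/
def CompletelyContractive {X : Type u} {Y : Type*} (w : ArrayWeight X)
    (N : ∀ m n : ℕ, Mat m n Y → ℝ) (f : X → Y) : Prop :=
  ∀ m n : ℕ, 0 < m → 0 < n → ∀ A : Mat m n X, N m n (ampl f A) ≤ w.toFun m n A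

/-- The minimal matrix-norm `MIN(V)` of a Banach space `V`: the supremum of the operator norms of
`M_{m,n}(φ)(A)` over the functionals `φ` of norm at most one. -/
def minNorm (V : Type*) [NormedAddCommGroup V] [NormedSpace ℂ V] (m n : ℕ) (A : Mat m n V) : ℝ :=
  sSup {r | ∃ φ : V →L[ℂ] ℂ, ‖φ‖ ≤ 1 ∧ r = opNorm (Matrix.of (ampl φ A))}

section free

variable {X : Type u} (w : ArrayWeight X)

/-- `N_X`: the vectors of the free vector space on `X` killed by all linear `φ` to `MIN(ℂ)` that
are completely contractive on the generators. -/
def nullSpace : Submodule ℂ (X →₀ ℂ) where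
  carrier := {v | ∀ φ : (X →₀ ℂ) →ₗ[ℂ] ℂ,
    CompletelyContractive w (minNorm ℂ) (fun x => φ (Finsupp.single x 1)) → φ v = 0}
  add_mem' := fun ha hb φ hφ => by rw [map_add, ha φ hφ, hb φ hφ, add_zero]
  zero_mem' := fun φ _ => map_zero φ
  smul_mem' := fun c v hv φ hφ => by rw [map_smul, hv φ hφ, smul_zero]

/-- `Q_X = V_X / N_X`. -/
abbrev QSpace : Type u := (X →₀ ℂ) ⧸ nullSpace w

/-- The image of a generator in `Q_X`. -/
def gen (x : X) : QSpace w := (nullSpace w).mkQ (Finsupp.single x 1)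

/-- The supremum of `‖M_{m,n}(φ)(A)‖_W` over all matricial Banach spaces `W` and all linear
`φ : Q_X → W` that are completely contractive on the generators. -/
def qNormFun (m n : ℕ) (A : Mat m n (QSpace w)) : ℝ :=
  sSup {r | ∃ (W : MBan.{u}) (φ : QSpace w →ₗ[ℂ] W),
    CompletelyContractive w W.mat.toFun (fun x => φ (gen w x)) ∧ r = W.norm (ampl φ A)}

theorem gen_bound (v : QSpace w) : ∃ K : ℝ, ∀ (W : MBan.{u}) (φ : QSpace w →ₗ[ℂ] W),
    CompletelyContractive w W.mat.toFun (fun x => φ (gen w x)) → ‖φ v‖ ≤ K := by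
  obtain ⟨f, rfl⟩ := (nullSpace w).mkQ_surjective v
  refine ⟨∑ x ∈ f.support, ‖f x‖ * w.toFun 1 1 (fun _ _ => x), fun W φ hφ => ?_⟩
  have h : (nullSpace w).mkQ f = ∑ x ∈ f.support, f x • gen w x := by
    conv_lhs => rw [← f.sum_single]
    rw [Finsupp.sum, map_sum]
    refine Finset.sum_congr rfl fun x _ => ?_
    rw [gen, ← map_smul, Finsupp.smul_single, smul_eq_mul, mul_one]
  rw [h, map_sum]
  refine (norm_sum_le _ _).trans (Finset.sum_le_sum fun x _ => ?_)
  rw [map_smul, norm_smul]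
  refine mul_le_mul_of_nonneg_left ?_ (norm_nonneg _)
  have h1 := hφ 1 1 one_pos one_pos (fun _ _ => x)
  exact (W.mat_one (φ (gen w x))).symm.le.trans h1

theorem bddAbove_qNorm {m n : ℕ} (A : Mat m n (QSpace w)) :
    BddAbove {r | ∃ (W : MBan.{u}) (φ : QSpace w →ₗ[ℂ] W),
      CompletelyContractive w W.mat.toFun (fun x => φ (gen w x)) ∧ r = W.norm (ampl φ A)} := by
  choose K hK using gen_bound w
  refine ⟨∑ i, ∑ j, K (A i j), ?_⟩
  rintro _ ⟨W, φ, hφ, rfl⟩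
  refine (W.mat.le_sum_entries _).trans
    (Finset.sum_le_sum fun i _ => Finset.sum_le_sum fun j _ => ?_)
  exact (W.mat_one (φ (A i j))).le.trans (hK _ W φ hφ)

theorem qNormFun_nonneg {m n : ℕ} (A : Mat m n (QSpace w)) : 0 ≤ qNormFun w m n A :=
  Real.sSup_nonneg (by rintro _ ⟨W, φ, -, rfl⟩; exact W.mat.nonneg _)

/-- The matrix-norm of `Q_X`. -/
def qNorm : MatrixSeminorm (QSpace w) :=
  MatrixSeminorm.ofAct (qNormFun w) (qNormFun_nonneg w)
    (fun A B => by
      refine Real.sSup_le ?_ (add_nonneg (qNormFun_nonneg w A) (qNormFun_nonneg w B))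
      rintro _ ⟨W, φ, hφ, rfl⟩
      have h : ampl φ (A + B) = ampl φ A + ampl φ B := by ext i j; simp [ampl]
      rw [h]
      exact (W.mat.add_le _ _).trans (add_le_add
        (le_csSup (bddAbove_qNorm w A) ⟨W, φ, hφ, rfl⟩)
        (le_csSup (bddAbove_qNorm w B) ⟨W, φ, hφ, rfl⟩)))
    (fun A B C => by
      refine Real.sSup_le ?_ (mul_nonneg (mul_nonneg (opNorm_nonneg A) (qNormFun_nonneg w B))
        (opNorm_nonneg C))
      rintro _ ⟨W, φ, hφ, rfl⟩
      rw [ampl_act]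
      refine (W.mat.act_le _ _ _).trans (mul_le_mul_of_nonneg_right
        (mul_le_mul_of_nonneg_left ?_ (opNorm_nonneg A)) (opNorm_nonneg C))
      exact le_csSup (bddAbove_qNorm w B) ⟨W, φ, hφ, rfl⟩)

/-- The scaled-free matricial Banach space of an array-weighted set. -/
def mBanSp : MBan.{u} := (qNorm w).completion

/-- The scaled-free matricial Banach algebra of an array-weighted set: the Haagerup tensor algebra
of its scaled-free matricial Banach space. -/
def mBanAlg : MBanMul.{u} := haagTensorAlg (mBanSp w)

end free

end MatBan

end

/-! Every array over a singleton is constant, and in any matrix-norm the constant m × n array with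
entry v has norm √(mn)·‖v‖ (`const_eq`). Dividing the weights by √(mn) shows that a map from X is
completely contractive exactly when the image of the generator has norm at most b = `brn w`
(`completelyContractive_iff`).

If b = 0, every admissible functional kills the generator, so the quotient space, its completion,
all Haagerup powers and their sum vanish.

If b > 0, nothing is factored out and the free space is a line. On an elementary tensor v ⊗ C every
matrix-norm is at most ‖C‖_tr·‖v‖ (`elemTensor_le`, by Hahn–Banach and trace duality). The universal
norm of x ⊗ C is therefore at most b·‖C‖_tr, and AMAX(ℂ) with x ↦ b attains this. After rescaling
the generator by 1/b, the free space is AMAX(ℂ); `IsAmaxLine` records this.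

The Haagerup product of two such lines is again one (`IsAmaxLine.haag`): the upper bound is
`elemTensor_le` once more, and the lower bound is submultiplicativity of the trace norm. By
induction each tensor power is a copy of AMAX(ℂ) spanned by a power of the generator, and
multiplication adds exponents (`hmul_powGen`). The tensor algebra is thus an ℓ¹-sum of copies of
AMAX(ℂ), whose norm is the sum of the trace norms of the coefficient matrices. By `amaxNorm_ellOne`
this is the norm of AMAX(ℓ¹), and the product becomes convolution. The algebra axioms are checked on
ℓ¹ only and carried over by the isomorphism (`MBanAlgIso.of_equiv`), so associativity in the
Haagerup tensor algebra needs no separate argument. -/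

noncomputable section

namespace MatBan

/-! ### Operator norm and trace norm of scalar matrices -/

section scalarMatrices

open scoped Matrix.Norms.L2Operator

/-- The Hahn–Banach theorem for a seminorm on a complex vector space. -/
theorem exists_linear_le_seminorm {E : Type*} [AddCommGroup E] [Module ℂ E] (p : Seminorm ℂ E)
    (x : E) : ∃ f : E →ₗ[ℂ] ℂ, (∀ y, ‖f y‖ ≤ p y) ∧ f x = p x := by
  let _ : SeminormedAddCommGroup E := p.toAddGroupSeminorm.toSeminormedAddCommGroup
  let _ : NormedSpace ℂ E := ⟨fun c v => (map_smul_eq_mul p c v).le⟩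
  -- This form of Hahn–Banach gives norm at most one instead of exactly one, so it also covers
  -- vectors of seminorm zero.
  obtain ⟨g, hg, hgx⟩ := exists_dual_vector'' ℂ x
  refine ⟨g.toLinearMap, fun y => ?_, hgx⟩
  exact (g.le_opNorm y).trans (mul_le_of_le_one_left (norm_nonneg y) hg)

/-- A column vector, as a matrix. -/
abbrev colMatrix {m : ℕ} (u : Fin m → ℂ) : Matrix (Fin m) (Fin 1) ℂ := Matrix.replicateCol (Fin 1) u

/-- A row vector, as a matrix. -/
abbrev rowMatrix {m : ℕ} (u : Fin m → ℂ) : Matrix (Fin 1) (Fin m) ℂ := Matrix.replicateRow (Fin 1) u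

theorem opNorm_colMatrix_le {m : ℕ} (u : Fin m → ℂ) :
    opNorm (colMatrix u) ≤ ‖WithLp.toLp 2 u‖ := by
  unfold opNorm
  rw [Matrix.l2_opNorm_def]
  refine ContinuousLinearMap.opNorm_le_bound _ (norm_nonneg _) fun x => ?_
  have h : (Matrix.toEuclideanLin (colMatrix u)) x = x 0 • WithLp.toLp 2 u := by
    ext i
    simp [Matrix.toLpLin_apply, Matrix.mulVec, dotProduct, mul_comm]
  have hx : ‖x‖ = ‖x 0‖ := by
    rw [EuclideanSpace.norm_eq]; simp
  change ‖(Matrix.toEuclideanLin (colMatrix u)) x‖ ≤ _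
  rw [h, norm_smul, hx, mul_comm]

theorem opNorm_conjTranspose {m n : ℕ} (A : Matrix (Fin m) (Fin n) ℂ) :
    opNorm A.conjTranspose = opNorm A := Matrix.l2_opNorm_conjTranspose A

theorem opNorm_rowMatrix_le {m : ℕ} (u : Fin m → ℂ) :
    opNorm (rowMatrix u) ≤ ‖WithLp.toLp 2 u‖ := by
  have h : rowMatrix u = (colMatrix (star u)).conjTranspose := by
    ext i j; simp
  rw [h, opNorm_conjTranspose]
  refine (opNorm_colMatrix_le _).trans (le_of_eq ?_)
  simp [EuclideanSpace.norm_eq]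

/-- The operator norm is bounded by a bound of the associated sesquilinear form. -/
theorem opNorm_le_of_dotProduct {m n : ℕ} (B : Matrix (Fin n) (Fin m) ℂ) {K : ℝ} (hK : 0 ≤ K)
    (h : ∀ (u : Fin m → ℂ) (w : Fin n → ℂ),
      ‖w ⬝ᵥ B.mulVec u‖ ≤ K * (‖WithLp.toLp 2 u‖ * ‖WithLp.toLp 2 w‖)) : opNorm B ≤ K := by
  unfold opNorm
  rw [Matrix.l2_opNorm_def]
  refine ContinuousLinearMap.opNorm_le_bound _ hK fun x => ?_
  change ‖(Matrix.toEuclideanLin B) x‖ ≤ _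
  rw [Matrix.toLpLin_apply]
  set y : EuclideanSpace ℂ (Fin n) := WithLp.toLp 2 (B.mulVec (WithLp.ofLp x)) with hy
  -- The dot product is bilinear, so the test vector is the conjugate of y = Bx. This yields ‖y‖² ≤
  -- K‖x‖‖y‖, and ‖y‖ cancels.
  have h1 := h (WithLp.ofLp x) (star (WithLp.ofLp y))
  have h2 : ‖star (WithLp.ofLp y) ⬝ᵥ B.mulVec (WithLp.ofLp x)‖ = ‖y‖ ^ 2 := by
    have : star (WithLp.ofLp y) ⬝ᵥ B.mulVec (WithLp.ofLp x) = inner ℂ y y := by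
      rw [EuclideanSpace.inner_eq_star_dotProduct, dotProduct_comm]
    rw [this, inner_self_eq_norm_sq_to_K]
    simp
  have h3 : ‖WithLp.toLp 2 (star (WithLp.ofLp y))‖ = ‖y‖ := by simp [EuclideanSpace.norm_eq]
  rw [h2, h3] at h1
  rcases (norm_nonneg y).eq_or_lt with h0 | h0
  · rw [← h0]; exact mul_nonneg hK (norm_nonneg _)
  · have : ‖y‖ * ‖y‖ ≤ (K * ‖x‖) * ‖y‖ := by
      have := h1
      simp only [WithLp.toLp_ofLp] at this
      nlinarith
    exact le_of_mul_le_mul_right this h0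

theorem traceNorm_add_le {m n : ℕ} (C D : Matrix (Fin m) (Fin n) ℂ) :
    traceNorm (C + D) ≤ traceNorm C + traceNorm D := by
  refine traceNorm_le _ (add_nonneg (traceNorm_nonneg _) (traceNorm_nonneg _)) fun B => ?_
  rw [Matrix.add_mul, Matrix.trace_add, _root_.add_mul]
  exact (norm_add_le _ _).trans (add_le_add (norm_trace_le C B) (norm_trace_le D B))

theorem traceNorm_zero {m n : ℕ} : traceNorm (0 : Matrix (Fin m) (Fin n) ℂ) = 0 :=
  le_antisymm (traceNorm_le _ le_rfl (by simp)) (traceNorm_nonneg _)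

theorem traceNorm_smul_le {m n : ℕ} (c : ℂ) (C : Matrix (Fin m) (Fin n) ℂ) :
    traceNorm (c • C) ≤ ‖c‖ * traceNorm C := by
  refine traceNorm_le _ (mul_nonneg (norm_nonneg _) (traceNorm_nonneg _)) fun B => ?_
  rw [Matrix.smul_mul, Matrix.trace_smul, norm_smul, mul_assoc]
  exact mul_le_mul_of_nonneg_left (norm_trace_le C B) (norm_nonneg c)

/-- The number w · Bu is the trace of B times the rank-one matrix u wᵀ, whose operator norm is at
most ‖u‖‖w‖. -/
theorem opNorm_le_traceNorm {m n : ℕ} (B : Matrix (Fin m) (Fin n) ℂ) : opNorm B ≤ traceNorm B := by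
  refine opNorm_le_of_dotProduct B (traceNorm_nonneg B) fun u w => ?_
  have h : w ⬝ᵥ B.mulVec u = (B * (colMatrix u * rowMatrix w)).trace := by
    rw [← Matrix.mul_assoc, Matrix.trace_mul_comm]
    simp [Matrix.trace, Matrix.mul_apply, dotProduct, Matrix.mulVec]
  rw [h]
  refine (norm_trace_le _ _).trans (mul_le_mul_of_nonneg_left ?_ (traceNorm_nonneg B))
  exact (opNorm_mul_le _ _).trans (mul_le_mul (opNorm_colMatrix_le _) (opNorm_rowMatrix_le _)
    (opNorm_nonneg _) (norm_nonneg _))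

/-- The ideal property gives ‖CD‖_tr ≤ ‖C‖_tr ‖D‖_op, and the operator norm is below the trace norm.
Both the lower bound for Haagerup products of lines and the submultiplicativity of AMAX(ℓ¹) rest on
this. -/
theorem traceNorm_mul_le {m n l : ℕ} (C : Matrix (Fin m) (Fin n) ℂ)
    (D : Matrix (Fin n) (Fin l) ℂ) : traceNorm (C * D) ≤ traceNorm C * traceNorm D := by
  have h := traceNorm_mul_mul_le (1 : Matrix (Fin m) (Fin m) ℂ) C D
  rw [Matrix.one_mul] at h
  refine h.trans (mul_le_mul ?_ (opNorm_le_traceNorm D) (opNorm_nonneg D) (traceNorm_nonneg C))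
  exact mul_le_of_le_one_left (traceNorm_nonneg C) (opNorm_one_le m)

theorem norm_apply_le_traceNorm {m n : ℕ} (C : Matrix (Fin m) (Fin n) ℂ) (i : Fin m) (j : Fin n) :
    ‖C i j‖ ≤ traceNorm C := by
  have h := norm_trace_le C (Matrix.single j i 1)
  rw [Matrix.trace_mul_single] at h
  simp only [MulOpposite.op_one, one_smul] at h
  exact h.trans (mul_le_of_le_one_right (traceNorm_nonneg C) (opNorm_single_le j i))

theorem opNorm_one_by_one (B : Matrix (Fin 1) (Fin 1) ℂ) : opNorm B = ‖B 0 0‖ := by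
  have h : B = Matrix.diagonal fun _ => B 0 0 := by
    ext i j
    obtain rfl := Subsingleton.elim i 0
    obtain rfl := Subsingleton.elim j 0
    simp
  unfold opNorm
  conv_lhs => rw [h]
  rw [Matrix.l2_opNorm_diagonal, pi_norm_const]

theorem traceNorm_one_by_one (C : Matrix (Fin 1) (Fin 1) ℂ) : traceNorm C = ‖C 0 0‖ := by
  refine le_antisymm (traceNorm_le _ (norm_nonneg _) fun B => ?_) (norm_apply_le_traceNorm C 0 0)
  rw [opNorm_one_by_one, Matrix.trace, Fin.sum_univ_one, Matrix.diag, Matrix.mul_apply,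
    Fin.sum_univ_one, norm_mul]

/-- The operator norms form a matrix-norm on the complex numbers. -/
def opMatrixNorm : MatrixSeminorm ℂ :=
  MatrixSeminorm.ofAct (fun _ _ A => opNorm (Matrix.of A)) (fun _ => opNorm_nonneg _)
    (fun A B => norm_add_le (Matrix.of A) (Matrix.of B))
    (fun A B C => by
      have h : Matrix.of (act A B C) = A * Matrix.of B * C := by
        ext i j
        simp only [act, Matrix.of_apply, Matrix.mul_apply, Finset.sum_mul, smul_eq_mul]
        rw [Finset.sum_comm]
        exact Finset.sum_congr rfl fun b _ => Finset.sum_congr rfl fun a _ => by ring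
      rw [h]
      exact (opNorm_mul_le _ _).trans
        (mul_le_mul_of_nonneg_right (opNorm_mul_le _ _) (opNorm_nonneg C)))

theorem opMatrixNorm_apply {m n : ℕ} (A : Mat m n ℂ) : opMatrixNorm.toFun m n A = opNorm (Matrix.of A) :=
  rfl

end scalarMatrices

/-! ### Bounds valid for every matrix-norm -/

section seminorm

variable {V : Type*} [AddCommGroup V] [Module ℂ V]

/-- Every matrix-norm is at most the absolute maximum one, on elementary tensors. -/
theorem MatrixSeminorm.elemTensor_le (N : MatrixSeminorm V) {m n : ℕ} (v : V)
    (C : Matrix (Fin m) (Fin n) ℂ) :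
    N.toFun m n (elemTensor v C) ≤ traceNorm C * N.toFun 1 1 (fun _ _ => v) := by
  let q : Seminorm ℂ (Matrix (Fin m) (Fin n) ℂ) := Seminorm.of
    (fun C => N.toFun m n (elemTensor v C))
    (fun C D => by
      have : elemTensor v (C + D) = elemTensor v C + elemTensor v D := by
        ext i j; simp [elemTensor, add_smul]
      rw [this]; exact N.add_le _ _)
    (fun c C => by
      have : elemTensor v (c • C) = c • elemTensor v C := by
        ext i j; simp [elemTensor, smul_smul]
      rw [this]; exact N.smul _ _)
  obtain ⟨f, hf, hfC⟩ := exists_linear_le_seminorm q C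
  -- The matrix representing the norming functional f in the trace pairing: f D = tr(DB). It remains
  -- to bound its operator norm by the norm of v.
  let B : Matrix (Fin n) (Fin m) ℂ := fun j i => f (Matrix.single i j 1)
  have hfB : ∀ D, f D = (D * B).trace := by
    intro D
    conv_lhs => rw [Matrix.matrix_eq_sum_single D]
    simp only [map_sum, Matrix.trace, Matrix.diag, B]
    refine Finset.sum_congr rfl fun i _ => Finset.sum_congr rfl fun j _ => ?_
    rw [← smul_eq_mul, ← map_smul, Matrix.smul_single, smul_eq_mul, mul_one]
  have hB : opNorm B ≤ N.toFun 1 1 (fun _ _ => v) := by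
    refine opNorm_le_of_dotProduct B (N.nonneg _) fun u w => ?_
    have h : w ⬝ᵥ B.mulVec u = f (colMatrix u * rowMatrix w) := by
      rw [hfB, Matrix.trace_mul_comm, ← Matrix.mul_assoc, Matrix.trace_mul_comm]
      simp [Matrix.trace, Matrix.mul_apply, dotProduct, Matrix.mulVec]
    -- Rank-one matrices suffice to test the operator norm of B, and on them v ⊗ u wᵀ is the 1 × 1
    -- array v multiplied by a column and a row, so `act_le` applies.
    have h2 : elemTensor v (colMatrix u * rowMatrix w)
        = act (colMatrix u) (fun _ _ => v : Mat 1 1 V) (rowMatrix w) := by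
      ext i j; simp [elemTensor, act, Matrix.mul_apply]
    rw [h]
    refine (hf _).trans ?_
    change N.toFun m n (elemTensor v (colMatrix u * rowMatrix w)) ≤ _
    rw [h2]
    refine (N.act_le _ _ _).trans ?_
    calc _ ≤ ‖WithLp.toLp 2 u‖ * N.toFun 1 1 (fun _ _ => v) * ‖WithLp.toLp 2 w‖ :=
          mul_le_mul (mul_le_mul_of_nonneg_right (opNorm_colMatrix_le u) (N.nonneg _))
            (opNorm_rowMatrix_le w) (opNorm_nonneg _) (mul_nonneg (norm_nonneg _) (N.nonneg _))
      _ = _ := by ring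
  have hC : N.toFun m n (elemTensor v C) = ‖f C‖ := by
    rw [hfC, Complex.norm_real, Real.norm_of_nonneg (apply_nonneg q C)]; rfl
  rw [hC, hfB]
  exact (norm_trace_le C B).trans (mul_le_mul_of_nonneg_left hB (traceNorm_nonneg C))

theorem norm_toLp_const (m : ℕ) (c : ℂ) :
    ‖WithLp.toLp 2 (fun _ : Fin m => c)‖ = Real.sqrt m * ‖c‖ := by
  rw [EuclideanSpace.norm_eq]
  simp [Real.sqrt_mul]

/-- The norm of a constant array. -/
theorem MatrixSeminorm.const_eq (N : MatrixSeminorm V) {m n : ℕ} (hm : 0 < m) (hn : 0 < n)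
    (v : V) : N.toFun m n (fun _ _ => v) = Real.sqrt (m * n) * N.toFun 1 1 (fun _ _ => v) := by
  have hm' : (0 : ℝ) < m := Nat.cast_pos.2 hm
  have hn' : (0 : ℝ) < n := Nat.cast_pos.2 hn
  rw [Real.sqrt_mul hm'.le]
  have hsm := Real.sqrt_pos.2 hm'
  have hsn := Real.sqrt_pos.2 hn'
  apply le_antisymm
  -- Spread the 1 × 1 array with a column and a row of ones, of norms at most √m and √n.
  · have h : (fun _ _ => v : Mat m n V)
        = act (colMatrix fun _ => 1) (fun _ _ => v : Mat 1 1 V) (rowMatrix fun _ => 1) := by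
      ext i j; simp [act]
    rw [h]
    refine (N.act_le _ _ _).trans ?_
    have h1 := opNorm_colMatrix_le (fun _ : Fin m => (1 : ℂ))
    have h2 := opNorm_rowMatrix_le (fun _ : Fin n => (1 : ℂ))
    rw [norm_toLp_const, norm_one, mul_one] at h1 h2
    calc _ ≤ Real.sqrt m * N.toFun 1 1 (fun _ _ => v) * Real.sqrt n :=
          mul_le_mul (mul_le_mul_of_nonneg_right h1 (N.nonneg _)) h2 (opNorm_nonneg _)
            (mul_nonneg hsm.le (N.nonneg _))
      _ = _ := by ring
  -- Conversely, average the entries: a row with entries 1/m and a column with entries 1/n have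
  -- norms at most 1/√m and 1/√n.
  · have h : (fun _ _ => v : Mat 1 1 V)
        = act (rowMatrix fun _ => (m : ℂ)⁻¹) (fun _ _ => v : Mat m n V)
          (colMatrix fun _ => (n : ℂ)⁻¹) := by
      ext i j
      have h1 : (m : ℂ) ≠ 0 := Nat.cast_ne_zero.2 hm.ne'
      have h2 : (n : ℂ) ≠ 0 := Nat.cast_ne_zero.2 hn.ne'
      simp only [act, Matrix.replicateRow_apply, Matrix.replicateCol_apply, Finset.sum_const,
        Finset.card_univ, Fintype.card_fin, ← Nat.cast_smul_eq_nsmul ℂ, smul_smul]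
      rw [show (m : ℂ) * (n * ((m : ℂ)⁻¹ * (n : ℂ)⁻¹)) = 1 by field_simp, one_smul]
    have h1 := opNorm_rowMatrix_le (fun _ : Fin m => (m : ℂ)⁻¹)
    have h2 := opNorm_colMatrix_le (fun _ : Fin n => (n : ℂ)⁻¹)
    have e : ∀ k : ℕ, Real.sqrt k * ‖(k : ℂ)⁻¹‖ = (Real.sqrt k)⁻¹ := fun k => by
      rw [norm_inv, Complex.norm_natCast, ← div_eq_mul_inv, Real.sqrt_div_self', one_div]
    rw [norm_toLp_const, e] at h1 h2
    have h3 : N.toFun 1 1 (fun _ _ => v)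
        ≤ (Real.sqrt m)⁻¹ * N.toFun m n (fun _ _ => v) * (Real.sqrt n)⁻¹ := by
      conv_lhs => rw [h]
      refine (N.act_le _ _ _).trans ?_
      exact mul_le_mul (mul_le_mul_of_nonneg_right h1 (N.nonneg _)) h2 (opNorm_nonneg _)
            (mul_nonneg (inv_nonneg.2 hsm.le) (N.nonneg _))
    calc _ ≤ Real.sqrt m * Real.sqrt n *
          ((Real.sqrt m)⁻¹ * N.toFun m n (fun _ _ => v) * (Real.sqrt n)⁻¹) :=
          mul_le_mul_of_nonneg_left h3 (mul_nonneg hsm.le hsn.le)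
      _ = _ := by field_simp

end seminorm

/-! ### Copies of AMAX(ℂ) and their Haagerup powers -/

section lines

/-- `P` is spanned by `e`, and `c ↦ c • e` is completely isometric from `AMAX(ℂ)` to `P`. -/
structure IsAmaxLine (P : MBan.{u}) (e : P) : Prop where
  span : ∀ v : P, ∃ c : ℂ, c • e = v
  norm_eq : ∀ {m n : ℕ} (C : Matrix (Fin m) (Fin n) ℂ), P.norm (elemTensor e C) = traceNorm C

namespace IsAmaxLine

variable {P Q : MBan.{u}} {e : P} {f : Q}

theorem norm_smul_eq (h : IsAmaxLine P e) (c : ℂ) : ‖c • e‖ = ‖c‖ := by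
  have h1 := h.norm_eq (Matrix.of fun _ _ => c : Matrix (Fin 1) (Fin 1) ℂ)
  rw [traceNorm_one_by_one] at h1
  exact (P.mat_one (c • e)).symm.trans h1

theorem bijective (h : IsAmaxLine P e) : Function.Bijective (LinearMap.toSpanSingleton ℂ P e) :=
  ⟨(injective_iff_map_eq_zero _).2 fun c hc => by
    rw [← norm_eq_zero, ← h.norm_smul_eq]; exact norm_eq_zero.2 hc, h.span⟩

/-- The coordinate with respect to the generator. -/
def coord (h : IsAmaxLine P e) : P →ₗ[ℂ] ℂ :=
  (LinearEquiv.ofBijective (LinearMap.toSpanSingleton ℂ P e) h.bijective).symm.toLinearMap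

theorem coord_smul (h : IsAmaxLine P e) (v : P) : h.coord v • e = v :=
  LinearEquiv.apply_symm_apply (LinearEquiv.ofBijective (LinearMap.toSpanSingleton ℂ P e) h.bijective) v

theorem norm_coord (h : IsAmaxLine P e) (v : P) : ‖h.coord v‖ = ‖v‖ := by
  rw [← h.norm_smul_eq, h.coord_smul]

theorem coord_self (h : IsAmaxLine P e) : h.coord e = 1 := by
  have h1 : (h.coord e - 1) • e = 0 := by rw [sub_smul, h.coord_smul, one_smul, sub_self]
  have h2 := h.norm_smul_eq (h.coord e - 1)
  rw [h1, norm_zero] at h2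
  exact sub_eq_zero.1 (norm_eq_zero.1 h2.symm)

theorem norm_eq_traceNorm (h : IsAmaxLine P e) {m n : ℕ} (A : Mat m n P) :
    P.norm A = traceNorm (Matrix.of (ampl h.coord A)) := by
  rw [← h.norm_eq]
  congr 1
  ext i j
  exact (h.coord_smul (A i j)).symm

/-- A finite-dimensional subspace is closed, so the dense image of the line is already the whole
completion. -/
theorem completion {V : Type u} [AddCommGroup V] [Module ℂ V] (N : MatrixSeminorm V) (e : V)
    (hs : ∀ v : V, ∃ c : ℂ, c • e = v)
    (hN : ∀ {m n : ℕ} (C : Matrix (Fin m) (Fin n) ℂ), N.toFun m n (elemTensor e C) = traceNorm C) :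
    IsAmaxLine N.completion (N.kappa e) where
  span v := by
    have hcl : IsClosed ((ℂ ∙ (N.kappa e : Completion N.Space) :
        Submodule ℂ (Completion N.Space)) : Set (Completion N.Space)) :=
      Submodule.closed_of_finiteDimensional _
    have h : ∀ x : Completion N.Space, x ∈ (ℂ ∙ (N.kappa e : Completion N.Space)) := fun x => by
      refine Completion.induction_on x hcl fun y => ?_
      obtain ⟨c, hc⟩ := hs y
      rw [Submodule.mem_span_singleton]
      exact ⟨c, (map_smul N.kappa c e).symm.trans (congrArg N.kappa hc)⟩
    exact Submodule.mem_span_singleton.1 (h v)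
  norm_eq {m n} C := by
    rw [← hN C]
    refine Eq.trans ?_ (N.limNorm_kappa (elemTensor e C))
    change N.limNorm m n _ = _
    congr 1
    ext i j
    exact (map_smul N.kappa (C i j) e).symm

/-- The upper bound is `elemTensor_le`, since e ⊗ f has norm at most one. For the lower bound, the
product of the two coordinate functionals turns A ⊙ B into the product of the coordinate matrices,
so by `traceNorm_mul_le` the trace norm of the coordinates is below the cost of every decomposition.
-/
theorem haag (hP : IsAmaxLine P e) (hQ : IsAmaxLine Q f) :
    IsAmaxLine (haag P Q) (haagMk P Q e f) := by
  refine completion (haagNorm P Q) (e ⊗ₜ f) (fun t => ?_) fun {m n} C => ?_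
  · induction t using TensorProduct.induction_on with
    | zero => exact ⟨0, zero_smul _ _⟩
    | tmul v w =>
      refine ⟨hP.coord v * hQ.coord w, ?_⟩
      rw [← TensorProduct.smul_tmul_smul, hP.coord_smul, hQ.coord_smul]
    | add x y hx hy =>
      obtain ⟨a, rfl⟩ := hx
      obtain ⟨b, rfl⟩ := hy
      exact ⟨a + b, add_smul _ _ _⟩
  · apply le_antisymm
    · refine ((haagNorm P Q).elemTensor_le _ C).trans
        (mul_le_of_le_one_right (traceNorm_nonneg C) ?_)
      have h : (fun _ _ => e ⊗ₜ f : Mat 1 1 (P ⊗[ℂ] Q))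
          = haagAtom P Q 1 1 ⟨1, fun _ _ => e, fun _ _ => f⟩ := by
        ext i j; simp [haagAtom, matMul]
      rw [h]
      refine (decompNorm_atom_le haagCost_nonneg
        (⟨1, fun _ _ => e, fun _ _ => f⟩ : Σ q : ℕ, Mat 1 q P × Mat q 1 Q)).trans ?_
      have he := hP.norm_smul_eq 1
      have hf := hQ.norm_smul_eq 1
      rw [one_smul, norm_one] at he hf
      have h1 : P.norm (fun _ _ => e : Mat 1 1 P) = 1 := (P.mat_one e).trans he
      have h2 : Q.norm (fun _ _ => f : Mat 1 1 Q) = 1 := (Q.mat_one f).trans hf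
      simp only [haagCost]
      rw [h1, h2, one_mul]
    · let l : P ⊗[ℂ] Q →ₗ[ℂ] ℂ :=
        TensorProduct.lift ((LinearMap.mul ℂ ℂ).compl₁₂ hP.coord hQ.coord)
      have hl : ∀ v w, l (v ⊗ₜ w) = hP.coord v * hQ.coord w := fun v w => by simp [l]
      have h := le_mul_decompNorm (cost := haagCost P Q m n) haag_span
        (g := fun B => traceNorm (Matrix.of (ampl l B)))
        (by
          have : Matrix.of (ampl l (0 : Mat m n (P ⊗[ℂ] Q))) = 0 := by ext i j; simp [ampl]
          rw [this, traceNorm_zero])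
        (fun x y => by
          have : Matrix.of (ampl l (x + y)) = Matrix.of (ampl l x) + Matrix.of (ampl l y) := by
            ext i j; simp [ampl]
          rw [this]; exact traceNorm_add_le _ _)
        zero_le_one
        (fun a => by
          have : Matrix.of (ampl l (haagAtom P Q m n a))
              = Matrix.of (ampl hP.coord a.2.1) * Matrix.of (ampl hQ.coord a.2.2) := by
            ext i j; simp [ampl, haagAtom, matMul, hl, Matrix.mul_apply]
          rw [this, one_mul, haagCost, hP.norm_eq_traceNorm, hQ.norm_eq_traceNorm]
          exact traceNorm_mul_le _ _)
        (elemTensor (e ⊗ₜ f) C)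
      rw [one_mul] at h
      refine le_trans (le_of_eq ?_) h
      congr 1
      ext i j
      simp [ampl, elemTensor, hl, hP.coord_self, hQ.coord_self]

/-- The tensor powers of the generator. -/
def powGen (V : MBan.{u}) (e : V) : (n : ℕ) → hpow V n
  | 0 => e
  | n + 1 => haagMk (hpow V n) V (powGen V e n) e

theorem hpow {V : MBan.{u}} {e : V} (h : IsAmaxLine V e) :
    ∀ n, IsAmaxLine (hpow V n) (powGen V e n)
  | 0 => h
  | n + 1 => (hpow h n).haag h

end IsAmaxLine

open IsAmaxLine (powGen)

/-- The recursion follows that of `hmul` and splits off the last tensor factor. Index n stands for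
the (n+1)-fold power, so exponents i+1 and j+1 add up to the exponent with index i+j+1. -/
theorem hmul_powGen (V : MBan.{u}) (e : V) (i : ℕ) : ∀ j : ℕ,
    (hmul V i j).1 (powGen V e i) (powGen V e j) = powGen V e (i + j + 1)
  | 0 => rfl
  | j + 1 => by
    change stepExt (hmul V i j).2 V (powGen V e i)
      (haagIncl (hpow V j) V (powGen V e j ⊗ₜ e)) = haagMk _ V (powGen V e (i + j + 1)) e
    rw [stepExt_incl, stepAux_tmul, hmul_powGen V e i j]

end lines

/-! ### The free matricial Banach space of a singleton -/

section singleton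

variable {X : Type u} (w : ArrayWeight X)

theorem bddBelow_brn : BddBelow {r | ∃ (m n : ℕ) (A : Mat m n X), 0 < m ∧ 0 < n ∧
    r = w.toFun m n A / Real.sqrt ((m : ℝ) * n)} :=
  ⟨0, by rintro _ ⟨m, n, A, hm, hn, rfl⟩; exact div_nonneg (w.nonneg hm hn A) (Real.sqrt_nonneg _)⟩

variable [Unique X]

/-- Complete contractivity on a singleton is a bound on the norm of the image. -/
theorem completelyContractive_iff {V : Type*} [AddCommGroup V] [Module ℂ V] (N : MatrixSeminorm V)
    (f : X → V) : CompletelyContractive w N.toFun f ↔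
      N.toFun 1 1 (fun _ _ => f default) ≤ brn w := by
  -- All arrays are constant, so `const_eq` produces the factor √(mn), which is the denominator in
  -- `brn`.
  have hA : ∀ {m n : ℕ} (A : Mat m n X), ampl f A = fun _ _ => f default := fun A => by
    ext i j; rw [ampl, Subsingleton.elim (A i j) default]
  constructor
  · intro h
    refine le_csInf ⟨_, 1, 1, fun _ _ => default, one_pos, one_pos, rfl⟩ ?_
    rintro _ ⟨m, n, A, hm, hn, rfl⟩
    have h1 := h m n hm hn A
    rw [hA, N.const_eq hm hn] at h1
    rw [le_div_iff₀ (Real.sqrt_pos.2 (by positivity)), mul_comm]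
    exact h1
  · intro h m n hm hn A
    rw [hA, N.const_eq hm hn]
    have h1 : brn w ≤ w.toFun m n A / Real.sqrt ((m : ℝ) * n) :=
      csInf_le (bddBelow_brn w) ⟨m, n, A, hm, hn, rfl⟩
    have h2 := h.trans h1
    rw [le_div_iff₀ (Real.sqrt_pos.2 (by positivity)), mul_comm] at h2
    exact h2

/-- A functional on ℂ is multiplication by φ 1, of modulus at most one here, and the identity
attains the supremum. -/
theorem minNorm_complex {m n : ℕ} (A : Mat m n ℂ) : minNorm ℂ m n A = opMatrixNorm.toFun m n A := by
  have hle : ∀ r ∈ {r | ∃ φ : ℂ →L[ℂ] ℂ, ‖φ‖ ≤ 1 ∧ r = opNorm (Matrix.of (ampl φ A))},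
      r ≤ opMatrixNorm.toFun m n A := by
    rintro _ ⟨φ, hφ, rfl⟩
    have h : ampl φ A = φ 1 • A := by
      ext i j
      simp only [ampl, Pi.smul_apply, smul_eq_mul]
      rw [mul_comm, ← smul_eq_mul, ← map_smul, smul_eq_mul, mul_one]
    rw [h, ← opMatrixNorm_apply, opMatrixNorm.smul]
    refine mul_le_of_le_one_left (opMatrixNorm.nonneg A) ((φ.le_opNorm 1).trans ?_)
    rw [norm_one, mul_one]
    exact hφ
  refine le_antisymm (csSup_le ⟨_, 0, by simp, rfl⟩ hle) (le_csSup ⟨_, hle⟩ ?_)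
  exact ⟨ContinuousLinearMap.id ℂ ℂ, ContinuousLinearMap.norm_id_le, rfl⟩

theorem mem_nullSpace_iff (v : X →₀ ℂ) : v ∈ nullSpace w ↔
    ∀ φ : (X →₀ ℂ) →ₗ[ℂ] ℂ, ‖φ (Finsupp.single default 1)‖ ≤ brn w → φ v = 0 := by
  have h : minNorm ℂ = opMatrixNorm.toFun := by
    funext m n A; exact minNorm_complex A
  have h1 : ∀ c : ℂ, opMatrixNorm.toFun 1 1 (fun _ _ => c) = ‖c‖ := fun c =>
    opNorm_one_by_one _
  change (∀ φ : (X →₀ ℂ) →ₗ[ℂ] ℂ,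
    CompletelyContractive w (minNorm ℂ) (fun x => φ (Finsupp.single x 1)) → φ v = 0) ↔ _
  simp only [h, completelyContractive_iff, h1]

theorem single_default_span (v : X →₀ ℂ) : v default • Finsupp.single default 1 = v := by
  rw [Finsupp.smul_single, smul_eq_mul, mul_one, ← Finsupp.unique_single v]

theorem nullSpace_eq_bot (hw : 0 < brn w) : nullSpace w = ⊥ := by
  rw [eq_bot_iff]
  intro v hv
  -- The coordinate functional scaled by b is admissible, and it is nonzero on the generator because
  -- b > 0.
  have h := (mem_nullSpace_iff w v).1 hv ((brn w : ℂ) • Finsupp.lapply default) (by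
    simp [abs_of_pos hw])
  have h1 : v default = 0 := by simpa [hw.ne'] using h
  rw [Submodule.mem_bot, ← single_default_span v, h1, zero_smul]

theorem nullSpace_eq_top (hw : brn w = 0) : nullSpace w = ⊤ := by
  rw [eq_top_iff]
  intro v _
  rw [mem_nullSpace_iff]
  intro φ hφ
  rw [← single_default_span v, map_smul, norm_le_zero_iff.1 (hφ.trans hw.le), smul_zero]

theorem gen_span (v : QSpace w) : ∃ c : ℂ, c • gen w default = v := by
  obtain ⟨f, rfl⟩ := (nullSpace w).mkQ_surjective v
  exact ⟨f default, by rw [gen, ← map_smul, single_default_span]⟩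

/-- The universal norm on the free space over a singleton is a multiple of the trace norm. -/
theorem qNorm_elemTensor (hw : 0 < brn w) {m n : ℕ} (C : Matrix (Fin m) (Fin n) ℂ) :
    (qNorm w).toFun m n (elemTensor (gen w default) C) = traceNorm C * brn w := by
  change qNormFun w m n _ = _
  have hle : ∀ r ∈ {r | ∃ (W : MBan.{u}) (φ : QSpace w →ₗ[ℂ] W),
      CompletelyContractive w W.mat.toFun (fun x => φ (gen w x)) ∧
        r = W.norm (ampl φ (elemTensor (gen w default) C))}, r ≤ traceNorm C * brn w := by
    rintro _ ⟨W, φ, hφ, rfl⟩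
    rw [completelyContractive_iff] at hφ
    have h : ampl φ (elemTensor (gen w default) C) = elemTensor (φ (gen w default)) C := by
      ext i j; simp [ampl, elemTensor]
    rw [h]
    exact (W.mat.elemTensor_le _ C).trans (mul_le_mul_of_nonneg_left hφ (traceNorm_nonneg C))
  -- The extremal map, sending the generator to b in AMAX(ℂ). The lift places ℂ in the universe over
  -- which the supremum is taken.
  let ψ : QSpace w →ₗ[ℂ] ULift.{u} ℂ := (nullSpace w).liftQ
    ((brn w : ℂ) • ULift.moduleEquiv.symm.toLinearMap ∘ₗ Finsupp.lapply default)
    (by rw [nullSpace_eq_bot w hw]; exact bot_le)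
  have hψ : ψ (gen w default) = ULift.up (brn w : ℂ) := by
    have h : ψ (gen w default) = (brn w : ℂ) • ULift.up (1 : ℂ) := by
      simp [ψ, gen]
    rw [h]
    ext
    simp
  refine le_antisymm (csSup_le ?_ hle) ?_
  -- The zero map only witnesses that the supremum is over a non-empty set.
  · exact ⟨_, AMAX (ULift.{u} ℂ), (0 : QSpace w →ₗ[ℂ] ULift.{u} ℂ), by
      rw [completelyContractive_iff]
      refine le_trans (le_of_eq ?_) hw.le
      exact ((AMAX (ULift.{u} ℂ)).mat_one 0).trans norm_zero, rfl⟩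
  · refine le_csSup_of_le ⟨_, hle⟩ ⟨AMAX (ULift.{u} ℂ), ψ, ?_, rfl⟩ ?_
    · rw [completelyContractive_iff]
      refine le_of_eq (((AMAX (ULift.{u} ℂ)).mat_one _).trans ?_)
      change ‖ψ (gen w default)‖ = _
      rw [hψ, ULift.norm_up, Complex.norm_real, Real.norm_of_nonneg hw.le]
    -- In AMAX(ℂ) the trace norm of the coordinates is a lower bound: it is subadditive and at most
    -- the cost on each atom.
    · have h := le_mul_decompNorm (E := Mat m n (ULift.{u} ℂ))
        (cost := fun a : ULift.{u} ℂ × Matrix (Fin m) (Fin n) ℂ =>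
          ‖a.1‖ * traceNorm a.2) amax_span
        (g := fun B => traceNorm (Matrix.of (ampl ULift.down B)))
        (by
          have : Matrix.of (ampl ULift.down (0 : Mat m n (ULift.{u} ℂ))) = 0 := by
            ext i j; simp [ampl]
          rw [this, traceNorm_zero])
        (fun x y => by
          have : Matrix.of (ampl ULift.down (x + y))
              = Matrix.of (ampl ULift.down x) + Matrix.of (ampl ULift.down y) := by
            ext i j; simp [ampl]
          rw [this]; exact traceNorm_add_le _ _)
        zero_le_one
        (fun a => by
          have : Matrix.of (ampl ULift.down (elemTensor a.1 a.2)) = a.1.down • a.2 := by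
            ext i j; simp [ampl, elemTensor, mul_comm]
          rw [this, one_mul]
          exact traceNorm_smul_le _ _)
        (ampl ψ (elemTensor (gen w default) C))
      rw [one_mul] at h
      refine le_trans ?_ h
      have h2 : Matrix.of (ampl ULift.down (ampl ψ (elemTensor (gen w default) C)))
          = (brn w : ℂ) • C := by
        ext i j
        change (ψ (C i j • gen w default)).down = (brn w : ℂ) * C i j
        rw [map_smul, hψ]
        exact mul_comm _ _
      -- Homogeneity is available as an upper bound only; applied to the inverse scalar it gives
      -- ‖C‖_tr·b ≤ ‖bC‖_tr.
      have h3 := traceNorm_smul_le ((brn w : ℂ)⁻¹) ((brn w : ℂ) • C)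
      rw [smul_smul, inv_mul_cancel₀ (Complex.ofReal_ne_zero.2 hw.ne'), one_smul, norm_inv,
        Complex.norm_real, Real.norm_of_nonneg hw.le, inv_mul_eq_div, le_div_iff₀ hw] at h3
      simp only [h2]
      exact h3

/-- The generator has norm b, so dividing by b makes the universal norm equal to the trace norm. -/
theorem isAmaxLine_mBanSp (hw : 0 < brn w) :
    IsAmaxLine (mBanSp w) ((qNorm w).kappa ((brn w : ℂ)⁻¹ • gen w default)) := by
  have hb : (brn w : ℂ) ≠ 0 := Complex.ofReal_ne_zero.2 hw.ne'
  refine IsAmaxLine.completion _ _ (fun v => ?_) fun {m n} C => ?_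
  · obtain ⟨c, rfl⟩ := gen_span w v
    exact ⟨c * brn w, by rw [smul_smul, mul_assoc, mul_inv_cancel₀ hb, mul_one]⟩
  · have h : elemTensor ((brn w : ℂ)⁻¹ • gen w default) C
        = (brn w : ℂ)⁻¹ • elemTensor (gen w default) C := by
      ext i j; exact smul_comm _ _ _
    rw [h, (qNorm w).smul, qNorm_elemTensor w hw, norm_inv, Complex.norm_real,
      Real.norm_of_nonneg hw.le]
    field_simp

end singleton

/-! ### The matrix-norm of AMAX(ℓ¹) in coordinates -/

section ellOneAmax

theorem MBan.continuous_norm (V : MBan.{u}) (m n : ℕ) :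
    Continuous fun A : Mat m n V => V.norm A := by
  refine continuous_iff_continuousAt.2 fun A => tendsto_iff_dist_tendsto_zero.2 ?_
  have h : Filter.Tendsto (fun B : Mat m n V => ∑ i, ∑ j, ‖B i j - A i j‖) (𝓝 A) (𝓝 0) := by
    have hc : Continuous fun B : Mat m n V => ∑ i, ∑ j, ‖B i j - A i j‖ := by fun_prop
    simpa using hc.tendsto A
  refine squeeze_zero (fun _ => dist_nonneg) (fun B => ?_) h
  rw [Real.dist_eq]
  refine (V.mat.abs_sub_le B A).trans ((V.mat.le_sum_entries _).trans (le_of_eq ?_))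
  simp only [MBan.mat_one]
  rfl

theorem norm_apply_le_opNorm {m n : ℕ} (B : Matrix (Fin m) (Fin n) ℂ) (i : Fin m) (j : Fin n) :
    ‖B i j‖ ≤ opNorm B := by
  have h := opMatrixNorm.entry_le B i j
  rw [opMatrixNorm_apply, opNorm_one_by_one] at h
  exact h

theorem traceNorm_le_sum {m n : ℕ} (C : Matrix (Fin m) (Fin n) ℂ) :
    traceNorm C ≤ ∑ i, ∑ j, ‖C i j‖ := by
  refine traceNorm_le _ (Finset.sum_nonneg fun _ _ => Finset.sum_nonneg fun _ _ => norm_nonneg _)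
    fun B => ?_
  rw [Matrix.trace, Finset.sum_mul]
  refine (norm_sum_le _ _).trans (Finset.sum_le_sum fun i _ => ?_)
  rw [Matrix.diag, Matrix.mul_apply, Finset.sum_mul]
  refine (norm_sum_le _ _).trans (Finset.sum_le_sum fun j _ => ?_)
  rw [norm_mul]
  exact mul_le_mul_of_nonneg_left (norm_apply_le_opNorm B j i) (norm_nonneg _)

/-- The matrix of the `k`-th coordinates of an array of sequences. -/
def coeffMatrix {m n : ℕ} (k : ℕ+) (M : Mat m n EllOne) : Matrix (Fin m) (Fin n) ℂ :=
  Matrix.of fun i j => M i j k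

theorem hasSum_norm_ellOne (x : EllOne) : HasSum (fun k => ‖x k‖) ‖x‖ := by
  simpa using lp.hasSum_norm (by simp) x

theorem summable_traceNorm {m n : ℕ} (M : Mat m n EllOne) :
    Summable fun k => traceNorm (coeffMatrix k M) := by
  refine Summable.of_nonneg_of_le (fun k => traceNorm_nonneg _) (fun k => traceNorm_le_sum _) ?_
  exact summable_sum fun i _ => summable_sum fun j _ => (hasSum_norm_ellOne (M i j)).summable

/-- The matrix-norm of `AMAX(ℓ¹)` in coordinates. -/
theorem amaxNorm_ellOne {m n : ℕ} (M : Mat m n EllOne) :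
    amaxNorm EllOne m n M = ∑' k, traceNorm (coeffMatrix k M) := by
  apply le_antisymm
  -- Expand M as the sum of δ_k ⊗ C_k. Each finite partial sum has norm at most the sum of the trace
  -- norms, and the bound passes to the limit by continuity.
  · have hM : HasSum (fun k => elemTensor (lp.single 1 k (1 : ℂ) : EllOne) (coeffMatrix k M)) M := by
      refine Pi.hasSum.2 fun i => Pi.hasSum.2 fun j => ?_
      have h := lp.hasSum_single (p := 1) (by simp) (M i j)
      convert! h using 1
      ext1 k
      change M i j k • (lp.single 1 k (1 : ℂ) : EllOne) = _
      rw [← lp.single_smul, smul_eq_mul, mul_one]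
    have hc := ((AMAX EllOne).continuous_norm m n).tendsto M
    refine le_of_tendsto (hc.comp hM) (Filter.Eventually.of_forall fun s => ?_)
    refine ((AMAX EllOne).mat.sum_le s _).trans ?_
    refine le_trans (Finset.sum_le_sum fun k _ => ?_)
      ((summable_traceNorm M).sum_le_tsum s fun k _ => traceNorm_nonneg _)
    refine (decompNorm_atom_le
      (atom := fun a : EllOne × Matrix (Fin m) (Fin n) ℂ => elemTensor a.1 a.2) amax_cost_nonneg
      ((lp.single 1 k (1 : ℂ) : EllOne), coeffMatrix k M)).trans (le_of_eq ?_)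
    rw [lp.norm_single (by simp), norm_one, one_mul]
  -- The sum of trace norms is subadditive. On an atom v ⊗ C the coefficient matrices are v_k C, so
  -- there it is at most ‖v‖‖C‖_tr.
  · have h := le_mul_decompNorm (cost := fun a : EllOne × Matrix (Fin m) (Fin n) ℂ =>
        ‖a.1‖ * traceNorm a.2) amax_span
        (g := fun M => ∑' k, traceNorm (coeffMatrix k M))
        (by
          have : ∀ k, coeffMatrix k (0 : Mat m n EllOne) = 0 := fun k => by
            ext i j; simp [coeffMatrix]
          simp [this, traceNorm_zero])
        (fun x y => by
          rw [← (summable_traceNorm x).tsum_add (summable_traceNorm y)]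
          exact (summable_traceNorm _).tsum_le_tsum (fun k => traceNorm_add_le _ _)
            ((summable_traceNorm x).add (summable_traceNorm y)))
        zero_le_one
        (fun a => by
          have hs := (hasSum_norm_ellOne a.1).mul_right (traceNorm a.2)
          rw [one_mul, ← hs.tsum_eq]
          refine (summable_traceNorm _).tsum_le_tsum (fun k => ?_) hs.summable
          have : coeffMatrix k (elemTensor a.1 a.2) = a.1 k • a.2 := by
            ext i j; simp [coeffMatrix, elemTensor, mul_comm]
          rw [this]
          exact traceNorm_smul_le _ _) M
    rw [one_mul] at h
    exact h

end ellOneAmax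

/-! ### Convolution makes AMAX(ℓ¹) a matricial Banach algebra -/

section convolution

theorem convolution_apply (x y : EllOne) (n : ℕ+) :
    convolution x y n = ∑ k ∈ Finset.Iio n, x k * y (n - k) := rfl

theorem hasSum_norm_mul (x y : EllOne) :
    HasSum (fun p : ℕ+ × ℕ+ => ‖x p.1‖ * ‖y p.2‖) (‖x‖ * ‖y‖) :=
  (hasSum_norm_ellOne x).mul (hasSum_norm_ellOne y)
    ((hasSum_norm_ellOne x).summable.mul_of_nonneg (hasSum_norm_ellOne y).summable
      (fun _ => norm_nonneg _) fun _ => norm_nonneg _)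

theorem norm_single_mul (x y : EllOne) (p : ℕ+ × ℕ+) :
    ‖(lp.single 1 (p.1 + p.2) (x p.1 * y p.2) : EllOne)‖ = ‖x p.1‖ * ‖y p.2‖ := by
  rw [lp.norm_single (by simp), norm_mul]

/-- As an absolutely convergent double series of multiples of δ_{j+k}, convolution has the shape of
the product of the tensor algebra. The series also yields the norm bound. -/
theorem hasSum_convolution (x y : EllOne) :
    HasSum (fun p : ℕ+ × ℕ+ => (lp.single 1 (p.1 + p.2) (x p.1 * y p.2) : EllOne))
      (convolution x y) := by
  have hs : Summable fun p : ℕ+ × ℕ+ => (lp.single 1 (p.1 + p.2) (x p.1 * y p.2) : EllOne) :=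
    Summable.of_norm_bounded (hasSum_norm_mul x y).summable fun p => (norm_single_mul x y p).le
  convert hs.hasSum using 1
  ext n
  have h := (hs.hasSum.mapL (lp.evalCLM ℂ (fun _ : ℕ+ => ℂ) 1 n)).tsum_eq
  refine Eq.trans ?_ h
  -- Only pairs with sum n contribute to the n-th coordinate. Subtraction in ℕ+ is truncated, so k +
  -- (n - k) = n relies on k < n.
  rw [tsum_eq_sum (s := (Finset.Iio n).image fun k => (k, n - k))]
  · rw [Finset.sum_image (fun a _ b _ hab => congrArg Prod.fst hab), convolution_apply]
    refine Finset.sum_congr rfl fun k hk => ?_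
    have hk' : k + (n - k) = n := PNat.add_sub_of_lt (Finset.mem_Iio.1 hk)
    change _ = (lp.single 1 (k + (n - k)) (x k * y (n - k)) : EllOne) n
    rw [lp.single_apply]
    simp [hk']
  · rintro ⟨a, b⟩ hab
    change (lp.single 1 (a + b) (x a * y b) : EllOne) n = 0
    rw [lp.single_apply_ne]
    rintro rfl
    exact hab (Finset.mem_image.2 ⟨a, Finset.mem_Iio.2 (PNat.lt_add_right a b), by
      rw [add_comm a b, PNat.add_sub]⟩)

theorem norm_convolution_le (x y : EllOne) : ‖convolution x y‖ ≤ ‖x‖ * ‖y‖ := by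
  rw [← (hasSum_convolution x y).tsum_eq]
  exact tsum_of_norm_bounded (hasSum_norm_mul x y) fun p => (norm_single_mul x y p).le

/-- The generating function of a sequence. -/
def genFun (x : EllOne) : PowerSeries ℂ :=
  PowerSeries.mk fun n => if h : 0 < n then x ⟨n, h⟩ else 0

theorem coeff_genFun (x : EllOne) (n : ℕ+) : PowerSeries.coeff n (genFun x) = x n := by
  simp only [genFun, PowerSeries.coeff_mk, PNat.pos, dif_pos]
  rfl

theorem coeff_zero_genFun (x : EllOne) : PowerSeries.coeff 0 (genFun x) = 0 := by
  simp [genFun]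

theorem genFun_injective : Function.Injective genFun := fun x y h => by
  ext n
  rw [← coeff_genFun, h, coeff_genFun]

/-- This gives associativity of convolution from that of power series. The constant coefficients are
zero, so the antidiagonal terms with a zero index drop out and the pairs (k, n - k) with 0 < k < n
remain. -/
theorem genFun_convolution (x y : EllOne) : genFun (convolution x y) = genFun x * genFun y := by
  ext n
  rw [PowerSeries.coeff_mul]
  rcases Nat.eq_zero_or_pos n with rfl | hn
  · simp [coeff_zero_genFun]
  · lift n to ℕ+ using hn
    rw [coeff_genFun, convolution_apply]
    refine Finset.sum_of_injOn (fun k : ℕ+ => ((k : ℕ), ((n - k : ℕ+) : ℕ))) ?_ ?_ ?_ ?_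
    · intro a _ b _ hab
      exact PNat.coe_injective (congrArg Prod.fst hab)
    · intro k hk
      have := PNat.add_sub_of_lt (Finset.mem_Iio.1 hk)
      simp only [Finset.mem_coe, Finset.HasAntidiagonal.mem_antidiagonal]
      rw [← PNat.add_coe, this]
    · rintro ⟨a, b⟩ hab hn
      rw [Finset.HasAntidiagonal.mem_antidiagonal] at hab
      rcases Nat.eq_zero_or_pos a with rfl | ha
      · rw [coeff_zero_genFun, zero_mul]
      rcases Nat.eq_zero_or_pos b with rfl | hb
      · rw [coeff_zero_genFun, mul_zero]
      refine absurd ?_ hn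
      lift a to ℕ+ using ha
      lift b to ℕ+ using hb
      have hab' : a + b = n := PNat.coe_injective hab
      subst hab'
      refine ⟨a, Finset.mem_coe.2 (Finset.mem_Iio.2 (PNat.lt_add_right a b)), ?_⟩
      simp only [add_comm a b, PNat.add_sub]
    · intro k _
      rw [coeff_genFun, coeff_genFun]

/-- Convolution as a bilinear map. -/
def convolutionₗ : EllOne →ₗ[ℂ] EllOne →ₗ[ℂ] EllOne :=
  LinearMap.mk₂ ℂ convolution
    (fun x y z => by
      ext n; simp [convolution_apply, _root_.add_mul, Finset.sum_add_distrib])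
    (fun c x y => by
      ext n; simp [convolution_apply, Finset.mul_sum, _root_.mul_assoc])
    (fun x y z => by
      ext n; simp [convolution_apply, _root_.mul_add, Finset.sum_add_distrib])
    (fun c x y => by
      ext n; simp [convolution_apply, Finset.mul_sum, mul_left_comm])

theorem convolutionₗ_apply (x y : EllOne) : convolutionₗ x y = convolution x y := rfl

theorem matMul_elemTensor {m p n : ℕ} (x y : EllOne) (C : Matrix (Fin m) (Fin p) ℂ)
    (D : Matrix (Fin p) (Fin n) ℂ) :
    matMul convolution (elemTensor x C) (elemTensor y D) = elemTensor (convolution x y) (C * D) := by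
  ext1 i; ext1 k
  simp only [matMul, elemTensor, ← convolutionₗ_apply, map_smul, LinearMap.smul_apply, smul_smul,
    ← Finset.sum_smul, Matrix.mul_apply]
  congr 1
  exact Finset.sum_congr rfl fun j _ => mul_comm _ _

theorem convolution_assoc (x y z : EllOne) :
    convolution (convolution x y) z = convolution x (convolution y z) := by
  refine genFun_injective ?_
  simp only [genFun_convolution, _root_.mul_assoc]

/-- Decomposing one factor at a time reduces the bound to elementary tensors, where it is the
product of the bounds for convolution and for the trace norm. Each `mul_comm` moves the norm of the
factor held fixed into the place of the constant in `le_mul_decompNorm`. -/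
theorem amaxNorm_matMul_convolution_le {m p n : ℕ} (M : Mat m p EllOne) (N : Mat p n EllOne) :
    amaxNorm EllOne m n (matMul convolution M N)
      ≤ amaxNorm EllOne m p M * amaxNorm EllOne p n N := by
  have hzero : amaxNorm EllOne m n 0 ≤ 0 := decompNorm_zero_le amax_cost_nonneg
  have hadd : ∀ x y, amaxNorm EllOne m n (x + y) ≤ amaxNorm EllOne m n x + amaxNorm EllOne m n y :=
    fun x y => decompNorm_add_le amax_cost_nonneg amax_span x y
  have hN : 0 ≤ amaxNorm EllOne p n N := decompNorm_nonneg amax_cost_nonneg N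
  rw [mul_comm]
  refine le_mul_decompNorm (cost := fun a : EllOne × Matrix (Fin m) (Fin p) ℂ =>
      ‖a.1‖ * traceNorm a.2) amax_span
      (g := fun M => amaxNorm EllOne m n (matMul convolution M N)) ?_ ?_ hN (fun a => ?_) M
  · have h : matMul convolution (0 : Mat m p EllOne) N = 0 := by
      ext1 i; ext1 k; simp [matMul, ← convolutionₗ_apply]
    simp only [h, hzero]
  · intro x y
    have h : matMul convolution (x + y) N = matMul convolution x N + matMul convolution y N := by
      ext1 i; ext1 k; simp [matMul, ← convolutionₗ_apply, Finset.sum_add_distrib]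
    simp only [h, hadd]
  · rw [mul_comm]
    refine le_mul_decompNorm (cost := fun a : EllOne × Matrix (Fin p) (Fin n) ℂ =>
      ‖a.1‖ * traceNorm a.2) amax_span
      (g := fun N => amaxNorm EllOne m n (matMul convolution (elemTensor a.1 a.2) N)) ?_ ?_
      (amax_cost_nonneg a) (fun b => ?_) N
    · have h : matMul convolution (elemTensor a.1 a.2) (0 : Mat p n EllOne) = 0 := by
        ext1 i; ext1 k; simp [matMul, ← convolutionₗ_apply]
      simp only [h, hzero]
    · intro x y
      have h : matMul convolution (elemTensor a.1 a.2) (x + y)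
          = matMul convolution (elemTensor a.1 a.2) x
            + matMul convolution (elemTensor a.1 a.2) y := by
        ext1 i; ext1 k; simp [matMul, ← convolutionₗ_apply, Finset.sum_add_distrib]
      simp only [h, hadd]
    · simp only [matMul_elemTensor]
      refine (decompNorm_atom_le amax_cost_nonneg (convolution a.1 b.1, a.2 * b.2)).trans ?_
      calc _ ≤ (‖a.1‖ * ‖b.1‖) * (traceNorm a.2 * traceNorm b.2) :=
            mul_le_mul (norm_convolution_le _ _) (traceNorm_mul_le _ _) (traceNorm_nonneg _)
              (mul_nonneg (norm_nonneg _) (norm_nonneg _))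
        _ = _ := by ring

theorem isMBanAlg_amax_ellOne : IsMBanAlg (amaxAlg EllOne convolution) where
  add_mul x y z := LinearMap.congr_fun (map_add convolutionₗ x y) z
  mul_add x y z := map_add (convolutionₗ x) y z
  smul_mul c x y := LinearMap.congr_fun (map_smul convolutionₗ c x) y
  mul_smul c x y := map_smul (convolutionₗ x) c y
  mul_assoc := convolution_assoc
  norm_matMul_le _ _ _ := amaxNorm_matMul_convolution_le

end convolution

/-! ### The isomorphism between ℓ¹ and the tensor algebra of a line -/

section iso

/-- The structure of a matricial Banach algebra is transported along a completely isometric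
isomorphism. -/
theorem MBanAlgIso.of_equiv {A : MBanMul.{u}} {B : MBanMul} (hB : IsMBanAlg B)
    (ψ : B.carrier ≃ₗ[ℂ] A.carrier) (hmul : ∀ x y, ψ (B.mul x y) = A.mul (ψ x) (ψ y))
    (hψ : ∀ (m n : ℕ) (M : Mat m n B.carrier), A.norm (ampl ψ M) = B.norm M) :
    MBanAlgIso A B := by
  have hM : ∀ {m n : ℕ} (M : Mat m n A.carrier), ∃ M' : Mat m n B.carrier, ampl ψ M' = M :=
    fun M => ⟨ampl ψ.symm M, by ext i j; simp [ampl]⟩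
  refine ⟨⟨?_, ?_, ?_, ?_, ?_, ?_⟩, hB, ψ.symm, ?_, ?_⟩
  · refine ψ.surjective.forall₃.2 fun x y z => ?_
    simp only [← map_add, ← hmul, hB.add_mul]
  · refine ψ.surjective.forall₃.2 fun x y z => ?_
    simp only [← map_add, ← hmul, hB.mul_add]
  · refine fun c => ψ.surjective.forall₂.2 fun x y => ?_
    simp only [← map_smul, ← hmul, hB.smul_mul]
  · refine fun c => ψ.surjective.forall₂.2 fun x y => ?_
    simp only [← map_smul, ← hmul, hB.mul_smul]
  · refine ψ.surjective.forall₃.2 fun x y z => ?_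
    simp only [← hmul, hB.mul_assoc]
  · intro m p n M N
    obtain ⟨M, rfl⟩ := hM M
    obtain ⟨N, rfl⟩ := hM N
    have h : matMul A.mul (ampl ψ M) (ampl ψ N) = ampl ψ (matMul B.mul M N) := by
      ext i k; simp [matMul, ampl, hmul]
    rw [h, hψ, hψ, hψ]
    exact hB.norm_matMul_le m p n M N
  · refine ψ.surjective.forall₂.2 fun x y => ?_
    simp only [← hmul, LinearEquiv.symm_apply_apply]
  · intro m n M
    obtain ⟨M, rfl⟩ := hM M
    rw [hψ]
    congr 1
    ext i j; simp [ampl]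

variable {P : ℕ → MBan.{u}} {e : ∀ i, P i}

/-- The isometry `x ↦ (x_{i+1} e_i)_i` from `ℓ¹` to an `ℓ¹`-direct sum of lines. -/
def lineSum (h : ∀ i, IsAmaxLine (P i) (e i)) :
    EllOne →ₗᵢ[ℂ] lp (fun i => (P i : Type u)) 1 where
  -- Summands are indexed from 0 and sequences from 1, hence the shift by one.
  toFun x := ⟨fun i => x i.succPNat • e i, memℓp_gen (by
    simp only [(h _).norm_smul_eq, ENNReal.toReal_one, Real.rpow_one]
    exact (hasSum_norm_ellOne x).summable.comp_injective Nat.succPNat_injective)⟩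
  map_add' x y := by ext i; exact add_smul _ _ _
  map_smul' c x := by ext i; exact mul_smul _ _ _
  norm_map' x := by
    refine (lp_one_norm P _).unique ?_
    convert! (Equiv.pnatEquivNat.symm.hasSum_iff).2 (hasSum_norm_ellOne x) using 2 with i
    exact (h i).norm_smul_eq _

theorem lineSum_apply (h : ∀ i, IsAmaxLine (P i) (e i)) (x : EllOne) (i : ℕ) :
    lineSum h x i = x i.succPNat • e i := rfl

/-- Coordinates have the norms of the components, so the coordinates of an element of the sum form
an absolutely summable sequence. -/
theorem lineSum_surjective (h : ∀ i, IsAmaxLine (P i) (e i)) :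
    Function.Surjective (lineSum h) := by
  intro z
  refine ⟨⟨fun k => (h k.natPred).coord (z k.natPred), memℓp_gen ?_⟩, ?_⟩
  · simp only [IsAmaxLine.norm_coord, ENNReal.toReal_one, Real.rpow_one]
    exact (lp_one_norm P z).summable.comp_injective Equiv.pnatEquivNat.injective
  · ext i
    rw [lineSum_apply]
    change (h (i.succPNat).natPred).coord (z (i.succPNat).natPred) • e i = z i
    rw [Nat.natPred_succPNat, IsAmaxLine.coord_smul]

/-- In the i-th summand the image array is e_i ⊗ C_{i+1}, of norm ‖C_{i+1}‖_tr; summing over i gives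
the formula of `amaxNorm_ellOne`. -/
theorem norm_lineSum (h : ∀ i, IsAmaxLine (P i) (e i)) {m n : ℕ} (M : Mat m n EllOne) :
    (ellOneSum P).norm (ampl (lineSum h) M) = (AMAX EllOne).norm M := by
  change sumNorm P m n _ = amaxNorm EllOne m n M
  rw [amaxNorm_ellOne, sumNorm, ← Equiv.pnatEquivNat.symm.tsum_eq]
  exact tsum_congr fun i => (h i).norm_eq (coeffMatrix i.succPNat M)

theorem lineSum_single (h : ∀ i, IsAmaxLine (P i) (e i)) (j : ℕ) (c : ℂ) :
    lineSum h (lp.single 1 j.succPNat c) = lp.single 1 j (c • e j) := by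
  ext i
  rw [lineSum_apply]
  rcases eq_or_ne i j with rfl | hij
  · rw [lp.single_apply_self, lp.single_apply_self]
  · rw [lp.single_apply_ne _ _ _ hij, lp.single_apply_ne _ _ _
      (fun h => hij (Nat.succPNat_injective h)), zero_smul]

open IsAmaxLine (powGen)

/-- The Haagerup tensor algebra of a line is `ℓ¹` with convolution. -/
theorem haagTensorAlg_iso {V : MBan.{u}} {v : V} (hv : IsAmaxLine V v) :
    MBanAlgIso (haagTensorAlg V) (amaxAlg EllOne convolution) := by
  let ψ := lineSum hv.hpow
  refine MBanAlgIso.of_equiv isMBanAlg_amax_ellOne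
    (LinearEquiv.ofBijective ψ.toLinearMap ⟨ψ.injective, lineSum_surjective hv.hpow⟩)
    (fun (x y : EllOne) => ?_) fun m n M => norm_lineSum hv.hpow M
  change ψ (convolution x y) = ∑' p : ℕ × ℕ,
    (lp.single 1 (p.1 + p.2 + 1) ((hmul V p.1 p.2).1 (ψ x p.1) (ψ y p.2)) :
      lp (fun i => (hpow V i : Type u)) 1)
  -- Being continuous, ψ can be applied termwise to the double series; reindexed by pairs from ℕ, it
  -- is then compared term by term with the series defining the tensor product.
  have h := (hasSum_convolution x y).mapL ψ.toContinuousLinearMap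
  rw [← (Equiv.prodCongr Equiv.pnatEquivNat.symm Equiv.pnatEquivNat.symm).hasSum_iff] at h
  refine h.tsum_eq.symm.trans (tsum_congr fun p => ?_)
  -- Both shifts by one are absorbed: (i+1) + (j+1) = (i+j+1) + 1, which matches the degree in
  -- `hmul`.
  have h1 : p.1.succPNat + p.2.succPNat = (p.1 + p.2 + 1).succPNat := by
    apply PNat.coe_injective
    simp only [PNat.add_coe, Nat.succPNat_coe]
    omega
  change ψ (lp.single 1 (p.1.succPNat + p.2.succPNat) (x p.1.succPNat * y p.2.succPNat)) = _
  rw [h1, lineSum_single, lineSum_apply, lineSum_apply, map_smul, map_smul, LinearMap.smul_apply,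
    hmul_powGen, smul_smul, mul_comm]

end iso

/-! ### The degenerate case: every construction collapses to zero -/

section trivial

theorem isMBanAlg_of_subsingleton (A : MBanMul.{u}) [Subsingleton A.carrier] : IsMBanAlg A where
  add_mul _ _ _ := Subsingleton.elim _ _
  mul_add _ _ _ := Subsingleton.elim _ _
  smul_mul _ _ _ := Subsingleton.elim _ _
  mul_smul _ _ _ := Subsingleton.elim _ _
  mul_assoc _ _ _ := Subsingleton.elim _ _
  norm_matMul_le m p n M N := by
    rw [Subsingleton.elim (matMul A.mul M N) 0]
    exact (A.mat.map_zero m n).le.trans (mul_nonneg (A.mat.nonneg M) (A.mat.nonneg N))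

theorem mBanAlgIso_zeroAlg (A : MBanMul.{u}) [Subsingleton A.carrier] : MBanAlgIso A zeroAlg := by
  have : Subsingleton zeroAlg.carrier := inferInstanceAs (Subsingleton PUnit)
  refine ⟨isMBanAlg_of_subsingleton A, isMBanAlg_of_subsingleton zeroAlg,
    LinearEquiv.ofSubsingleton _ _, fun _ _ => Subsingleton.elim _ _, fun m n M => ?_⟩
  rw [Subsingleton.elim M 0]
  exact (A.mat.map_zero m n).symm

theorem subsingleton_completion {V : Type u} [AddCommGroup V] [Module ℂ V] (N : MatrixSeminorm V)
    [Subsingleton V] : Subsingleton N.completion := by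
  have : Subsingleton N.Space := inferInstanceAs (Subsingleton V)
  have h : ∀ x : Completion N.Space, x = 0 := fun x => by
    refine Completion.induction_on x (isClosed_eq continuous_id continuous_const) fun y => ?_
    rw [Subsingleton.elim y 0, Completion.coe_zero]
  exact ⟨fun x y => (h x).trans (h y).symm⟩

theorem subsingleton_haag (V W : MBan.{u}) [Subsingleton V] : Subsingleton (haag V W) := by
  have : Subsingleton (V ⊗[ℂ] W) := inferInstance
  exact subsingleton_completion _

theorem subsingleton_hpow (V : MBan.{u}) [Subsingleton V] : ∀ n, Subsingleton (hpow V n)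
  | 0 => inferInstanceAs (Subsingleton V)
  | n + 1 => by
    have := subsingleton_hpow V n
    exact subsingleton_haag (hpow V n) V

theorem subsingleton_haagTensorAlg (V : MBan.{u}) [Subsingleton V] :
    Subsingleton (haagTensorAlg V).carrier := by
  have := subsingleton_hpow V
  exact ⟨fun x y => lp.ext (funext fun i => Subsingleton.elim _ _)⟩

theorem subsingleton_mBanSp {X : Type u} [Unique X] (w : ArrayWeight X) (hw : brn w = 0) :
    Subsingleton (mBanSp w) := by
  have : Subsingleton (QSpace w) :=
    Submodule.Quotient.subsingleton_iff.2 (nullSpace_eq_top w hw)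
  exact subsingleton_completion _

end trivial

end MatBan

end

theorem mainTheorem10 {X : Type u} [Unique X] (w : MatBan.ArrayWeight X) :
    (0 < MatBan.brn w →
      MatBan.MBanAlgIso (MatBan.mBanAlg w)
        (MatBan.amaxAlg MatBan.EllOne MatBan.convolution)) ∧
    (MatBan.brn w = 0 → MatBan.MBanAlgIso (MatBan.mBanAlg w) MatBan.zeroAlg) := by
  refine ⟨fun hw => MatBan.haagTensorAlg_iso (MatBan.isAmaxLine_mBanSp w hw), fun hw => ?_⟩
  have := MatBan.subsingleton_mBanSp w hw
  have := MatBan.subsingleton_haagTensorAlg (MatBan.mBanSp w)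
  exact MatBan.mBanAlgIso_zeroAlg (MatBan.haagTensorAlg (MatBan.mBanSp w))
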